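/- Let $R$ be an associative ring with unity; modules are left $R$-modules and complexes are indexed homologically over $\mathbb{Z}$. A complex $T$ is \emph{totally $\mathcal F$-acyclic} if it is an exact complex of projective modules such that $\operatorname{Hom}_R(T,F)$ is exact for every flat module $F$. A module is \emph{Ding projective} (strongly Gorenstein flat) if it is isomorphic to $\operatorname{Coker}(T_1\to T_0)$ for some totally $\mathcal F$-acyclic complex $T$. For a module $M$ let $$\operatorname{Dpd}(M)=\inf\{n\in\mathbb{N}_0 \mid \text{there is an exact sequence } 0\to G_n\to\cdots\to G_1\to G_0\to M\to 0 \text{ with every } G_i \text{ Ding projective}\}.$$ A complex $P$ is \emph{DG-projective} if every $P_i$ is projective and $\operatorname{Hom}_R(P,E)$ is exact for every exact complex $E$. An \emph{$\mathcal F$-complete resolution} of a complex $X$ is a diagram of morphisms of complexes $T\xrightarrow{\tau}P\xrightarrow{\pi}X$ in which $T$ is totally $\mathcal F$-acyclic, $P$ is DG-projective, $\pi$ is a quasi-isomorphism, and $\tau_i$ is bijective for all $i\gg 0$. For a complex $X$ let $$\operatorname{Dpd}_R(X)=\inf\{n\in\mathbb{Z} \mid \text{there is an } \mathcal F\text{-complete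 resolution } T\xrightarrow{\tau}P\xrightarrow{\pi}X \text{ with } \tau_i \text{ bijective for each } i\ge n\}.$$ Both infima are taken in $\mathbb{R}\cup\{-\infty,\infty\}$, so $\inf\emptyset=\infty$ and the infimum of a set of integers that is not bounded below is $-\infty$. Let $M$ be a nonzero $R$-module, and let $S^0(M)$ be the complex with $M$ in degree $0$ and $0$ in all other degrees. Then $$\operatorname{Dpd}_R(S^0(M))=\operatorname{Dpd}(M).$$ -/

import Mathlib

open CategoryTheory CategoryTheory.Limits

universe u

noncomputable section

namespace Ding

/-! ### Tensor products and flatness over a noncommutative ring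

Right `R`-modules are modules over the opposite ring `Rᵐᵒᵖ`. -/

section Flat

variable (R : Type u) [Ring R] (F : Type u) [AddCommGroup F] [Module R F]

/-- The subgroup of `N ⊗[ℤ] F` generated by the elements `(n · r) ⊗ x - n ⊗ (r · x)`. -/
def balancedRel (N : Type u) [AddCommGroup N] [Module Rᵐᵒᵖ N] :
    Submodule ℤ (TensorProduct ℤ N F) :=
  Submodule.span ℤ {t | ∃ (n : N) (r : R) (x : F),
    t = TensorProduct.tmul ℤ (MulOpposite.op r • n) x - TensorProduct.tmul ℤ n (r • x)}

/-- The abelian group `N ⊗_R F`, for a right `R`-module `N` and a left `R`-module `F`. -/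
abbrev BalancedTensor (N : Type u) [AddCommGroup N] [Module Rᵐᵒᵖ N] : Type u :=
  TensorProduct ℤ N F ⧸ balancedRel R F N

theorem balancedRel_le_comap {N N' : Type u} [AddCommGroup N] [Module Rᵐᵒᵖ N]
    [AddCommGroup N'] [Module Rᵐᵒᵖ N'] (f : N →ₗ[Rᵐᵒᵖ] N') :
    balancedRel R F N ≤
      (balancedRel R F N').comap (f.toAddMonoidHom.toIntLinearMap.rTensor F) := by
  refine Submodule.span_le.2 ?_
  rintro _ ⟨n, r, x, rfl⟩
  refine Submodule.subset_span ⟨f n, r, x, ?_⟩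
  simp

/-- The homomorphism `f ⊗_R F : N ⊗_R F → N' ⊗_R F`. -/
def BalancedTensor.map {N N' : Type u} [AddCommGroup N] [Module Rᵐᵒᵖ N]
    [AddCommGroup N'] [Module Rᵐᵒᵖ N'] (f : N →ₗ[Rᵐᵒᵖ] N') :
    BalancedTensor R F N →ₗ[ℤ] BalancedTensor R F N' :=
  Submodule.mapQ _ _ (f.toAddMonoidHom.toIntLinearMap.rTensor F) (balancedRel_le_comap R F f)

/-- A left `R`-module `F` is flat if `- ⊗_R F` preserves injectivity of homomorphisms of
right `R`-modules. -/
def IsFlat : Prop :=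
  ∀ (N N' : Type u) [AddCommGroup N] [Module Rᵐᵒᵖ N] [AddCommGroup N'] [Module Rᵐᵒᵖ N']
    (f : N →ₗ[Rᵐᵒᵖ] N'), Function.Injective f →
      Function.Injective (BalancedTensor.map R F f)

end Flat

variable {R : Type u} [Ring R]

/-! ### Ding projective modules -/

/-- A complex `T` of left `R`-modules is totally `𝓕`-acyclic (`𝓕` the class of flat modules) if
it is an exact complex of projective modules and `Hom_R(T, F)` is exact for every flat `F`. -/
structure IsTotallyFlatAcyclic (T : ChainComplex (ModuleCat.{u} R) ℤ) : Prop where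
  projective : ∀ n : ℤ, Projective (T.X n)
  acyclic : T.Acyclic
  hom_exact : ∀ F : ModuleCat.{u} R, IsFlat R F → ∀ n : ℤ,
    Function.Exact
      (fun g : T.X (n - 1) ⟶ F => T.d n (n - 1) ≫ g)
      (fun g : T.X n ⟶ F => T.d (n + 1) n ≫ g)

/-- A left `R`-module is Ding projective (strongly Gorenstein flat) if it is, up to isomorphism,
the cokernel of `T₁ ⟶ T₀` for a totally `𝓕`-acyclic complex `T`. -/
def IsDingProjective (M : ModuleCat.{u} R) : Prop :=
  ∃ T : ChainComplex (ModuleCat.{u} R) ℤ,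
    IsTotallyFlatAcyclic T ∧ Nonempty (cokernel (T.d 1 0) ≅ M)

/-- An exact sequence `0 ⟶ G n ⟶ ⋯ ⟶ G 1 ⟶ G 0 ⟶ M ⟶ 0` of left `R`-modules in which all `G i`
are Ding projective. It is extended by zero modules `G i`, `i > n`, so that exactness at `G n` is
the injectivity of `G n ⟶ G (n - 1)` (of `G 0 ⟶ M` if `n = 0`). -/
structure DingResolution (M : ModuleCat.{u} R) (n : ℕ) where
  G : ℕ → ModuleCat.{u} R
  d : ∀ i : ℕ, G (i + 1) ⟶ G i
  ε : G 0 ⟶ M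
  dingProjective : ∀ i ≤ n, IsDingProjective (G i)
  isZero : ∀ i, n < i → IsZero (G i)
  surjective_ε : Function.Surjective ε
  exact_zero : Function.Exact (d 0) ε
  exact_succ : ∀ i : ℕ, Function.Exact (d (i + 1)) (d i)

/-- The Ding projective (strongly Gorenstein flat) dimension of a module: the infimum, in the
extended reals, of the lengths `n ≥ 0` of its resolutions by Ding projective modules. It is `⊤`
if there is no such resolution. -/
def moduleDpd (M : ModuleCat.{u} R) : EReal :=
  sInf {x : EReal | ∃ n : ℕ, Nonempty (DingResolution M n) ∧ x = ((n : ℝ) : EReal)}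

/-! ### Ding projective dimension of complexes -/

/-- A complex `P` is DG-projective if all `P n` are projective and `Hom_R(P, E)` is exact for every
exact complex `E`. The second condition is that every morphism from `P` to an exact complex is
null-homotopic (apply it to all shifts of `E`), which is Mathlib's notion of a K-projective
complex. Mathlib states it for cochain complexes, so `P` is re-indexed by `P^n = P_{-n}`. -/
structure IsDGProjective (P : ChainComplex (ModuleCat.{u} R) ℤ) : Prop where
  projective : ∀ n : ℤ, Projective (P.X n)
  isKProjective : CochainComplex.IsKProjective
    ((ChainComplex.cochainComplexEquivalence (ModuleCat.{u} R)).functor.obj P)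

/-- An `𝓕`-complete resolution `T ⟶ P ⟶ X` of a complex `X`: `π : P ⟶ X` is a DG-projective
resolution, `T` is totally `𝓕`-acyclic and `τ i` is bijective for all large `i`. -/
structure CompleteResolution (X : ChainComplex (ModuleCat.{u} R) ℤ) where
  T : ChainComplex (ModuleCat.{u} R) ℤ
  P : ChainComplex (ModuleCat.{u} R) ℤ
  τ : T ⟶ P
  π : P ⟶ X
  isTotallyFlatAcyclic : IsTotallyFlatAcyclic T
  isDGProjective : IsDGProjective P
  quasiIso : QuasiIso π
  eventually_bijective : ∃ g : ℤ, ∀ i ≥ g, Function.Bijective (τ.f i)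

/-- The Ding projective dimension of a complex `X`: the infimum, in the extended reals, of all
`n : ℤ` such that `X` has an `𝓕`-complete resolution with `τ i` bijective for each `i ≥ n`. -/
def complexDpd (X : ChainComplex (ModuleCat.{u} R) ℤ) : EReal :=
  sInf {x : EReal | ∃ n : ℤ,
    (∃ C : CompleteResolution X, ∀ i ≥ n, Function.Bijective (C.τ.f i)) ∧
      x = ((n : ℝ) : EReal)}

/-- The complex `S⁰(M)` with `M` in degree `0` and zero in all other degrees. -/
abbrev sphere (M : ModuleCat.{u} R) : ChainComplex (ModuleCat.{u} R) ℤ :=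
  (HomologicalComplex.single (ModuleCat.{u} R) (ComplexShape.down ℤ) 0).obj M

end Ding

end

/-! For `M ≠ 0` the two infima run over the same integers: a Ding projective resolution of length
`n` exists exactly when there is an `𝓕`-complete resolution with `τ` bijective in degrees `≥ n`, and
negative `n` cannot occur on the complex side.

From modules to complexes, induct on `n`. A Ding projective module comes with a totally acyclic `T`,
and the truncation of `T` to nonnegative degrees is a projective resolution. For `0 → K → G → M → 0`
with `G` Ding projective, lift `K → G` to the projective resolutions. Since the complete complex of
`G` has projective, hence flat, terms, exactness of `Hom(T, -)` on flat modules extends the lift to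
negative degrees. The cones of the two lifts form a complete resolution of `M`, with the bound
raised by one (`HasCompleteResolution.step`).

Conversely, let `T → P → S⁰(M)` be complete; `P` may be nonzero in negative degrees, but it is exact
there. Hence `P` projects onto the exact complex `0 → B → P₋₁ → P₋₂ → ⋯`, with `B` the image of
`P₀`. By DG-projectivity this projection is null-homotopic, which makes `B`, and then the cycles
`Z₀`, projective. So `⋯ → P₂ → P₁ → Z₀ → M` is a projective resolution, and for `n ≥ 1` its cokernel
in degree `n` is also one of `T`, hence Ding projective. For `n = 0` the cokernel of `T₁ → T₀` is `M
⊕ B`, and `B` is removed by splitting a complex `B = B` off `T` (`isDingProjective_of_split`). -/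

noncomputable section

namespace Ding

/-! ### Projective modules are flat -/

section Flat

variable (R : Type u) [Ring R] (F : Type u) [AddCommGroup F] [Module R F]

/-- The action of a fixed element of a right module, as an additive map on the ring. -/
def smulHom (N : Type u) [AddCommGroup N] [Module Rᵐᵒᵖ N] : N →+ R →+ N :=
  AddMonoidHom.mk' (fun n => AddMonoidHom.mk' (fun r => MulOpposite.op r • n)
    (fun a b => by simp [add_smul])) (fun a b => by ext r; simp)

/-- For `s : F → R^(F)`, the map `N ⊗_R F → N^(F)` sending `n ⊗ x` to `n · s x`. -/
def tensorCoord (s : F →ₗ[R] F →₀ R) (N : Type u) [AddCommGroup N] [Module Rᵐᵒᵖ N] :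
    BalancedTensor R F N →+ (F →₀ N) :=
  (Submodule.liftQ (balancedRel R F N)
    (TensorProduct.lift (AddMonoidHom.toIntLinearMap
      (AddMonoidHom.mk' (fun n => ((Finsupp.mapRange.addMonoidHom (smulHom R N n)).comp
        s.toAddMonoidHom).toIntLinearMap) (fun a b => by ext x y; simp))))
    (by
      refine Submodule.span_le.2 ?_
      rintro _ ⟨n, r, x, rfl⟩
      refine LinearMap.mem_ker.2 ((map_sub _ _ _).trans (sub_eq_zero.2 ?_))
      change Finsupp.mapRange.addMonoidHom (smulHom R N (MulOpposite.op r • n)) (s x) =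
        Finsupp.mapRange.addMonoidHom (smulHom R N n) (s (r • x))
      ext y
      simp [smulHom, mul_smul])).toAddMonoidHom

theorem tensorCoord_tmul (s : F →ₗ[R] F →₀ R) (N : Type u) [AddCommGroup N] [Module Rᵐᵒᵖ N]
    (n : N) (x : F) :
    tensorCoord R F s N (Submodule.Quotient.mk (TensorProduct.tmul ℤ n x)) =
      Finsupp.mapRange.addMonoidHom (smulHom R N n) (s x) := rfl

theorem quotient_mk_smul_tmul (N : Type u) [AddCommGroup N] [Module Rᵐᵒᵖ N]
    (n : N) (r : R) (x : F) :
    (Submodule.Quotient.mk (TensorProduct.tmul ℤ (MulOpposite.op r • n) x) :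
      BalancedTensor R F N) = Submodule.Quotient.mk (TensorProduct.tmul ℤ n (r • x)) :=
  (Submodule.Quotient.eq _).2 (Submodule.subset_span ⟨n, r, x, rfl⟩)

/-- The map `N^(F) → N ⊗_R F` given by evaluation at the elements of `F`. -/
def tensorSum (N : Type u) [AddCommGroup N] [Module Rᵐᵒᵖ N] :
    (F →₀ N) →+ BalancedTensor R F N :=
  Finsupp.liftAddHom fun x =>
    ((balancedRel R F N).mkQ.comp ((TensorProduct.mk ℤ N F).flip x)).toAddMonoidHom

theorem tensorSum_single (N : Type u) [AddCommGroup N] [Module Rᵐᵒᵖ N] (x : F) (n : N) :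
    tensorSum R F N (Finsupp.single x n) = Submodule.Quotient.mk (TensorProduct.tmul ℤ n x) := by
  rw [tensorSum, Finsupp.liftAddHom_apply_single]; rfl

theorem tensorSum_mapRange (N : Type u) [AddCommGroup N] [Module Rᵐᵒᵖ N] (n : N) (c : F →₀ R) :
    tensorSum R F N (Finsupp.mapRange.addMonoidHom (smulHom R N n) c) =
      Submodule.Quotient.mk (TensorProduct.tmul ℤ n (Finsupp.linearCombination R id c)) := by
  induction c using Finsupp.induction_linear with
  | zero => simp
  | add f g hf hg => simp only [map_add, hf, hg, TensorProduct.tmul_add, Submodule.Quotient.mk_add]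
  | single x r =>
    have : Finsupp.mapRange.addMonoidHom (smulHom R N n) (Finsupp.single x r) =
        Finsupp.single x (MulOpposite.op r • n) := by
      simp [smulHom]
    rw [this, tensorSum_single, quotient_mk_smul_tmul]
    simp

theorem tensorSum_tensorCoord (s : F →ₗ[R] F →₀ R)
    (hs : ∀ x, Finsupp.linearCombination R id (s x) = x)
    (N : Type u) [AddCommGroup N] [Module Rᵐᵒᵖ N] (t : BalancedTensor R F N) :
    tensorSum R F N (tensorCoord R F s N t) = t := by
  obtain ⟨t, rfl⟩ := Submodule.Quotient.mk_surjective _ t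
  induction t using TensorProduct.induction_on with
  | zero => simp
  | add a b ha hb => simp only [Submodule.Quotient.mk_add, map_add, ha, hb]
  | tmul n x => rw [tensorCoord_tmul, tensorSum_mapRange, hs]

theorem tensorCoord_map (s : F →ₗ[R] F →₀ R) {N N' : Type u} [AddCommGroup N] [Module Rᵐᵒᵖ N]
    [AddCommGroup N'] [Module Rᵐᵒᵖ N'] (f : N →ₗ[Rᵐᵒᵖ] N') (t : BalancedTensor R F N) :
    tensorCoord R F s N' (BalancedTensor.map R F f t) =
      Finsupp.mapRange.addMonoidHom f.toAddMonoidHom (tensorCoord R F s N t) := by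
  obtain ⟨t, rfl⟩ := Submodule.Quotient.mk_surjective _ t
  induction t using TensorProduct.induction_on with
  | zero => simp
  | add a b ha hb => simp only [Submodule.Quotient.mk_add, map_add, ha, hb]
  | tmul n x =>
    have : BalancedTensor.map R F f (Submodule.Quotient.mk (TensorProduct.tmul ℤ n x)) =
      Submodule.Quotient.mk (TensorProduct.tmul ℤ (f n) x) := rfl
    rw [this, tensorCoord_tmul, tensorCoord_tmul]
    ext y
    simp [smulHom]

/-- A section `s` of `R^(F) → F` makes `N ⊗ F` a retract of `N^(F)`, with inclusion natural in `N`,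
and `N ↦ N^(F)` preserves injections. -/
theorem isFlat_of_projective [Module.Projective R F] : IsFlat R F := by
  intro N N' _ _ _ _ f hf
  obtain ⟨s, hs⟩ := Module.projective_def.1 (inferInstance : Module.Projective R F)
  intro a b hab
  have h := congrArg (tensorCoord R F s N') hab
  rw [tensorCoord_map, tensorCoord_map] at h
  have h' : tensorCoord R F s N a = tensorCoord R F s N b :=
    Finsupp.mapRange_injective (e := f) (map_zero f) hf h
  rw [← tensorSum_tensorCoord R F s hs N a, h', tensorSum_tensorCoord R F s hs N b]

end Flat

variable {R : Type u} [Ring R]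

theorem isFlat_of_projective_obj (Q : ModuleCat.{u} R) [Projective Q] : IsFlat R Q :=
  have : Module.Projective R Q := (IsProjective.iff_projective (R := R) Q).2 inferInstance
  isFlat_of_projective R Q

/-! ### Exactness and total acyclicity in terms of elements -/

theorem exactAt_iff_forall {c : ComplexShape ℤ} (C : HomologicalComplex (ModuleCat.{u} R) c)
    {i j k : ℤ} (hij : c.Rel i j) (hjk : c.Rel j k) :
    C.ExactAt j ↔ ∀ x : C.X j, C.d j k x = 0 → ∃ y : C.X i, C.d i j y = x := by
  rw [C.exactAt_iff' i j k (c.prev_eq' hij) (c.next_eq' hjk), ShortComplex.moduleCat_exact_iff]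
  rfl

theorem d_d_apply {c : ComplexShape ℤ} (C : HomologicalComplex (ModuleCat.{u} R) c)
    (i j k : ℤ) (x : C.X i) : C.d j k (C.d i j x) = 0 := by
  rw [← ConcreteCategory.comp_apply, C.d_comp_d]; rfl

theorem hom_d_apply {c : ComplexShape ℤ} {C D : HomologicalComplex (ModuleCat.{u} R) c}
    (f : C ⟶ D) (i j : ℤ) (x : C.X i) : f.f j (C.d i j x) = D.d i j (f.f i x) := by
  rw [← ConcreteCategory.comp_apply, ← f.comm, ConcreteCategory.comp_apply]

namespace IsTotallyFlatAcyclic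

variable {T : ChainComplex (ModuleCat.{u} R) ℤ}

theorem exists_d_apply_eq (hT : IsTotallyFlatAcyclic T) {i j k : ℤ} (hij : j + 1 = i)
    (hjk : k + 1 = j) (x : T.X j) (hx : T.d j k x = 0) : ∃ y : T.X i, T.d i j y = x :=
  (exactAt_iff_forall T (c := .down ℤ) hij hjk).1 (hT.acyclic j) x hx

theorem exists_d_comp_eq (hT : IsTotallyFlatAcyclic T) {i j k : ℤ} (hij : j + 1 = i)
    (hjk : k + 1 = j) {F : ModuleCat.{u} R} (hF : IsFlat R F) (g : T.X j ⟶ F)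
    (hg : T.d i j ≫ g = 0) : ∃ h : T.X k ⟶ F, T.d j k ≫ h = g := by
  obtain rfl : k = j - 1 := by lia
  subst hij
  exact (hT.hom_exact F hF j g).1 hg

theorem of_exists (hp : ∀ n, Projective (T.X n))
    (he : ∀ n (x : T.X n), T.d n (n - 1) x = 0 → ∃ y : T.X (n + 1), T.d (n + 1) n y = x)
    (hh : ∀ F : ModuleCat.{u} R, IsFlat R F → ∀ n (g : T.X n ⟶ F), T.d (n + 1) n ≫ g = 0 →
      ∃ h : T.X (n - 1) ⟶ F, T.d n (n - 1) ≫ h = g) : IsTotallyFlatAcyclic T where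
  projective := hp
  acyclic n := (exactAt_iff_forall T (c := .down ℤ) (i := n + 1) (k := n - 1) rfl
    (sub_add_cancel n 1)).2 (he n)
  hom_exact F hF n g := by
    refine ⟨hh F hF n g, ?_⟩
    rintro ⟨h, rfl⟩
    simp only [← Category.assoc, T.d_comp_d, zero_comp]

theorem of_retract {T' : ChainComplex (ModuleCat.{u} R) ℤ} (hT : IsTotallyFlatAcyclic T)
    (ι : T' ⟶ T) (r : T ⟶ T') (h : ι ≫ r = 𝟙 T') : IsTotallyFlatAcyclic T' := by
  have hf : ∀ n, ι.f n ≫ r.f n = 𝟙 _ := fun n => by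
    rw [← HomologicalComplex.comp_f, h, HomologicalComplex.id_f]
  refine of_exists (fun n => ?_) (fun n x hx => ?_) (fun F hF n g hg => ?_)
  · have := hT.projective n
    exact Retract.projective ⟨ι.f n, r.f n, hf n⟩
  · obtain ⟨y, hy⟩ := hT.exists_d_apply_eq (i := n + 1) rfl (sub_add_cancel n 1) (ι.f n x)
      (by rw [← hom_d_apply, hx, map_zero])
    refine ⟨r.f _ y, ?_⟩
    rw [← hom_d_apply, hy, ← ConcreteCategory.comp_apply, hf]; rfl
  · obtain ⟨k, hk⟩ := hT.exists_d_comp_eq (i := n + 1) rfl (sub_add_cancel n 1) hF (r.f n ≫ g)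
      (by rw [← Category.assoc, ← r.comm, Category.assoc, hg, comp_zero])
    refine ⟨ι.f _ ≫ k, ?_⟩
    rw [← Category.assoc, ← ι.comm, Category.assoc, hk, ← Category.assoc, hf, Category.id_comp]

end IsTotallyFlatAcyclic

theorem isDingProjective_iff (M : ModuleCat.{u} R) : IsDingProjective M ↔
    ∃ T : ChainComplex (ModuleCat.{u} R) ℤ, IsTotallyFlatAcyclic T ∧
      ∃ ε : T.X 0 ⟶ M, Function.Surjective ε ∧ Function.Exact (T.d 1 0) ε := by
  constructor
  · rintro ⟨T, hT, ⟨e⟩⟩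
    refine ⟨T, hT, cokernel.π _ ≫ e.hom, ?_, ?_⟩
    · rw [← ModuleCat.epi_iff_surjective]; infer_instance
    · have : (ShortComplex.mk (T.d 1 0) (cokernel.π _ ≫ e.hom) (by simp)).Exact :=
        ShortComplex.exact_of_g_is_cokernel _ (cokernel.cokernelIso _ _ e rfl)
      exact (ShortComplex.ShortExact.moduleCat_exact_iff_function_exact _).1 this
  · rintro ⟨T, hT, ε, hs, he⟩
    have w : T.d 1 0 ≫ ε = 0 := by
      ext x; exact he.apply_apply_eq_zero x
    have h : (ShortComplex.mk (T.d 1 0) ε w).Exact :=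
      (ShortComplex.ShortExact.moduleCat_exact_iff_function_exact _).2 he
    have : Epi ε := (ModuleCat.epi_iff_surjective _).2 hs
    exact ⟨T, hT, ⟨(colimit.isColimit _).coconePointUniqueUpToIso h.gIsCokernel⟩⟩

/-! ### Mapping cones -/

section Cofiber

open HomologicalComplex homotopyCofiber

variable {F G : ChainComplex (ModuleCat.{u} R) ℤ} (φ : F ⟶ G)

theorem cofiber_exists_eq {i j : ℤ} (hij : (ComplexShape.down ℤ).Rel i j)
    (x : (homotopyCofiber φ).X i) :
    ∃ (a : F.X j) (b : G.X i), x = inlX φ j i hij a + inrX φ i b := by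
  have h : fstX φ i j hij ≫ inlX φ j i hij + sndX φ i ≫ inrX φ i = 𝟙 _ := by
    apply ext_to_X φ i j hij <;> simp
  refine ⟨fstX φ i j hij x, sndX φ i x, ?_⟩
  have := ConcreteCategory.congr_hom h x
  simpa using this.symm

theorem cofiber_eq_zero {i j : ℤ} (hij : (ComplexShape.down ℤ).Rel i j) {a : F.X j} {b : G.X i}
    (h : inlX φ j i hij a + inrX φ i b = 0) : a = 0 ∧ b = 0 := by
  have h1 := congrArg (fstX φ i j hij) h
  have h2 := congrArg (sndX φ i) h
  simpa [← ConcreteCategory.comp_apply] using And.intro h1 h2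

theorem cofiber_d_apply {i j k : ℤ} (hij : (ComplexShape.down ℤ).Rel i j)
    (hjk : (ComplexShape.down ℤ).Rel j k) (a : F.X j) (b : G.X i) :
    (homotopyCofiber φ).d i j (inlX φ j i hij a + inrX φ i b) =
      inlX φ k j hjk (-F.d j k a) + inrX φ j (φ.f j a + G.d i j b) := by
  have h1 := ConcreteCategory.congr_hom (inlX_d φ i j k hij hjk) a
  have h2 := ConcreteCategory.congr_hom (inrX_d φ i j) b
  simp only [ConcreteCategory.comp_apply] at h1 h2
  rw [map_add]
  refine (congrArg₂ _ h1 h2).trans ?_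
  simp [add_assoc]

/-- Exactness is asked of `F` and `G` in one degree each, so that the lemma also serves for
resolutions, which are exact in positive degrees only. -/
theorem cofiber_exists_d_apply_eq {i j k l : ℤ} (hij : (ComplexShape.down ℤ).Rel i j)
    (hjk : (ComplexShape.down ℤ).Rel j k) (hkl : (ComplexShape.down ℤ).Rel k l)
    (hF : ∀ a : F.X k, F.d k l a = 0 → ∃ a' : F.X j, F.d j k a' = a)
    (hG : ∀ b : G.X j, G.d j k b = 0 → ∃ b' : G.X i, G.d i j b' = b)
    (x : (homotopyCofiber φ).X j) (hx : (homotopyCofiber φ).d j k x = 0) :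
    ∃ y : (homotopyCofiber φ).X i, (homotopyCofiber φ).d i j y = x := by
  obtain ⟨a, b, rfl⟩ := cofiber_exists_eq φ hjk x
  rw [cofiber_d_apply φ hjk hkl] at hx
  obtain ⟨ha, hb⟩ := cofiber_eq_zero φ hkl hx
  obtain ⟨a', rfl⟩ := hF a (neg_eq_zero.1 ha)
  obtain ⟨b', hb'⟩ := hG (b + φ.f j a') (by rw [map_add, ← hom_d_apply, add_comm, hb])
  refine ⟨inlX φ j i hij (-a') + inrX φ i b', ?_⟩
  rw [cofiber_d_apply φ hij hjk, hb']
  simp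

theorem cofiber_projective (hF : ∀ n, Projective (F.X n)) (hG : ∀ n, Projective (G.X n)) (n : ℤ) :
    Projective ((homotopyCofiber φ).X n) := by
  have := hF (n - 1)
  have := hG n
  exact Projective.of_iso (XIsoBiprod φ n (n - 1) (sub_add_cancel n 1)).symm inferInstance

/-- A cocycle `g` on the cone is first solved on the summand `G`, by `p`. The discrepancy `φ ≫ p -
g` on the summand `F` is then a cocycle, and total acyclicity of `F` supplies `q`. -/
theorem cofiber_isTotallyFlatAcyclic (hF : IsTotallyFlatAcyclic F) (hG : IsTotallyFlatAcyclic G) :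
    IsTotallyFlatAcyclic (homotopyCofiber φ) := by
  refine .of_exists (cofiber_projective φ hF.projective hG.projective) (fun n x hx => ?_)
    (fun E hE n g hg => ?_)
  · exact cofiber_exists_d_apply_eq φ (i := n + 1) (k := n - 1) (l := n - 1 - 1) rfl
      (sub_add_cancel _ _) (sub_add_cancel _ _)
      (hF.exists_d_apply_eq (sub_add_cancel _ _) (sub_add_cancel _ _))
      (hG.exists_d_apply_eq rfl (sub_add_cancel _ _)) x hx
  · have h0 : (ComplexShape.down ℤ).Rel (n + 1) n := rfl
    have h1 : (ComplexShape.down ℤ).Rel n (n - 1) := sub_add_cancel _ _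
    have h2 : (ComplexShape.down ℤ).Rel (n - 1) (n - 1 - 1) := sub_add_cancel _ _
    replace hg : homotopyCofiber.d φ (n + 1) n ≫ g = 0 := hg
    obtain ⟨p, hp⟩ := hG.exists_d_comp_eq h0 h1 hE (inrX φ n ≫ g) (by
      rw [← inrX_d_assoc, hg, comp_zero])
    have hq : F.d n (n - 1) ≫ inlX φ (n - 1) n h1 ≫ g = φ.f n ≫ G.d n (n - 1) ≫ p := by
      have := inlX_d φ (n + 1) n (n - 1) h0 h1 =≫ g
      simp only [Category.assoc, hg, comp_zero, Preadditive.add_comp, Preadditive.neg_comp] at this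
      rw [hp]
      exact (neg_add_eq_zero.1 this.symm)
    obtain ⟨q, hq⟩ := hF.exists_d_comp_eq h1 h2 hE
      (φ.f (n - 1) ≫ p - inlX φ (n - 1) n h1 ≫ g) (by
        rw [Preadditive.comp_sub, hq, φ.comm_assoc, sub_self])
    refine ⟨fstX φ (n - 1) (n - 1 - 1) h2 ≫ q + sndX φ (n - 1) ≫ p, ?_⟩
    apply ext_from_X φ (n - 1) n h1
    · rw [homotopyCofiber_d, inlX_d_assoc φ n (n - 1) (n - 1 - 1) h1 h2]
      simp [hq]
    · simp [hp]

variable {F' G' : ChainComplex (ModuleCat.{u} R) ℤ} (φ' : F' ⟶ G') (α : F ⟶ F') (β : G ⟶ G')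
  (w : α ≫ φ' = φ ≫ β)

/-- The morphism of homotopy cofibers induced by a commutative square. -/
def cofiberMap : homotopyCofiber φ ⟶ homotopyCofiber φ' :=
  mapArrowHom φ φ' (fun j => ⟨j + 1, rfl⟩) (Arrow.homMk α β w)

theorem cofiberMap_apply {i j : ℤ} (hij : (ComplexShape.down ℤ).Rel i j) (a : F.X j) (b : G.X i) :
    (cofiberMap φ φ' α β w).f i (inlX φ j i hij a + inrX φ i b) =
      inlX φ' j i hij (α.f j a) + inrX φ' i (β.f i b) := by
  have h1 : inlX φ j i hij ≫ (cofiberMap φ φ' α β w).f i = α.f j ≫ inlX φ' j i hij := by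
    simp [cofiberMap, mapArrowHom, inrCompHomotopy_hom _ _ _ _ hij]
  have h2 : inrX φ i ≫ (cofiberMap φ φ' α β w).f i = β.f i ≫ inrX φ' i := by
    simp [cofiberMap, mapArrowHom]
  rw [map_add]
  exact congrArg₂ _ (ConcreteCategory.congr_hom h1 a) (ConcreteCategory.congr_hom h2 b)

/-- Degree `i` of the cone involves the source in degree `i - 1`; this shift raises the dimension
bound by one. -/
theorem cofiberMap_bijective {i j : ℤ} (hij : (ComplexShape.down ℤ).Rel i j)
    (hα : Function.Bijective (α.f j)) (hβ : Function.Bijective (β.f i)) :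
    Function.Bijective ((cofiberMap φ φ' α β w).f i) := by
  constructor
  · rw [injective_iff_map_eq_zero]
    intro x hx
    obtain ⟨a, b, rfl⟩ := cofiber_exists_eq φ hij x
    rw [cofiberMap_apply] at hx
    obtain ⟨ha, hb⟩ := cofiber_eq_zero φ' hij hx
    rw [(injective_iff_map_eq_zero _).1 hα.1 a ha, (injective_iff_map_eq_zero _).1 hβ.1 b hb]
    simp
  · intro x
    obtain ⟨a, b, rfl⟩ := cofiber_exists_eq φ' hij x
    obtain ⟨a, rfl⟩ := hα.2 a
    obtain ⟨b, rfl⟩ := hβ.2 b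
    exact ⟨_, cofiberMap_apply φ φ' α β w hij a b⟩

end Cofiber

/-! ### Truncations and projective resolutions -/

/-- A morphism of complexes given separately in nonnegative and in negative degrees. -/
def homOfNat {C D : ChainComplex (ModuleCat.{u} R) ℤ}
    (p : ∀ n : ℕ, C.X (Int.ofNat n) ⟶ D.X (Int.ofNat n))
    (q : ∀ n : ℕ, C.X (Int.negSucc n) ⟶ D.X (Int.negSucc n))
    (hp : ∀ n : ℕ, p (n + 1) ≫ D.d (Int.ofNat (n + 1)) (Int.ofNat n) =
      C.d (Int.ofNat (n + 1)) (Int.ofNat n) ≫ p n)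
    (h0 : p 0 ≫ D.d (Int.ofNat 0) (Int.negSucc 0) = C.d (Int.ofNat 0) (Int.negSucc 0) ≫ q 0)
    (hq : ∀ n : ℕ, q n ≫ D.d (Int.negSucc n) (Int.negSucc (n + 1)) =
      C.d (Int.negSucc n) (Int.negSucc (n + 1)) ≫ q (n + 1)) : C ⟶ D where
  f
    | Int.ofNat n => p n
    | Int.negSucc n => q n
  comm' i j hij := by
    obtain rfl : j + 1 = i := hij
    match j with
    | Int.ofNat n => exact hp n
    | Int.negSucc 0 => exact h0
    | Int.negSucc (n + 1) => exact hq n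

section NatDeg

variable (T : ChainComplex (ModuleCat.{u} R) ℤ)

/-- The quotient complex of `T` that agrees with `T` in nonnegative degrees and vanishes in
negative degrees. -/
def nonnegPart : ChainComplex (ModuleCat.{u} R) ℤ where
  X
    | Int.ofNat n => T.X (Int.ofNat n)
    | Int.negSucc _ => ModuleCat.of R PUnit
  d
    | Int.ofNat m, Int.ofNat n => T.d (Int.ofNat m) (Int.ofNat n)
    | Int.ofNat _, Int.negSucc _ => 0
    | Int.negSucc _, Int.ofNat _ => 0
    | Int.negSucc _, Int.negSucc _ => 0
  shape i j hij := by
    match i, j with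
    | Int.ofNat m, Int.ofNat n => exact T.shape _ _ hij
    | Int.ofNat _, Int.negSucc _ => rfl
    | Int.negSucc _, Int.ofNat _ => rfl
    | Int.negSucc _, Int.negSucc _ => rfl
  d_comp_d' i j k _ _ := by
    match i, j, k with
    | Int.ofNat l, Int.ofNat m, Int.ofNat n => exact T.d_comp_d _ _ _
    | Int.negSucc _, Int.ofNat _, _ => exact zero_comp
    | Int.negSucc _, Int.negSucc _, _ => exact zero_comp
    | Int.ofNat _, Int.negSucc _, _ => exact zero_comp
    | Int.ofNat _, Int.ofNat _, Int.negSucc _ => exact comp_zero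

/-- The projection of a complex onto its nonnegative part. -/
def toNonnegPart : T ⟶ nonnegPart T :=
  homOfNat (fun _ => 𝟙 _) (fun _ => 0)
    (fun _ => (Category.id_comp _).trans (Category.comp_id _).symm)
    ((Category.id_comp _).trans comp_zero.symm) (fun _ => zero_comp.trans comp_zero.symm)

end NatDeg

/-- A projective resolution of `M`, regarded as a `ℤ`-indexed complex `P` vanishing in negative
degrees, with augmentation `ε`. -/
structure IsResolution {M : ModuleCat.{u} R} (P : ChainComplex (ModuleCat.{u} R) ℤ)
    (ε : P.X 0 ⟶ M) : Prop where
  projective : ∀ n : ℤ, Projective (P.X n)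
  isZero : ∀ n < 0, IsZero (P.X n)
  surjective : Function.Surjective ε
  exact_zero : Function.Exact (P.d 1 0) ε
  exactAt : ∀ n > 0, P.ExactAt n

namespace IsResolution

variable {M : ModuleCat.{u} R} {P : ChainComplex (ModuleCat.{u} R) ℤ} {ε : P.X 0 ⟶ M}

theorem isDGProjective (h : IsResolution P ε) : IsDGProjective P where
  projective := h.projective
  isKProjective := by
    have : CochainComplex.IsStrictlyLE
        ((ChainComplex.cochainComplexEquivalence (ModuleCat.{u} R)).functor.obj P) 0 := by
      rw [CochainComplex.isStrictlyLE_iff]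
      intro i hi
      exact h.isZero (-i) (by lia)
    have : ∀ n, Projective
        (((ChainComplex.cochainComplexEquivalence (ModuleCat.{u} R)).functor.obj P).X n) :=
      fun n => h.projective (-n)
    exact CochainComplex.isKProjective_of_projective _ 0

theorem d_comp (h : IsResolution P ε) : P.d 1 0 ≫ ε = 0 := by
  ext x; exact h.exact_zero.apply_apply_eq_zero x

/-- The morphism to the module concentrated in degree zero. -/
def π (h : IsResolution P ε) : P ⟶ sphere M :=
  HomologicalComplex.mkHomToSingle ε (fun i hi => by
    obtain rfl : i = 1 := hi.symm
    exact h.d_comp)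

theorem quasiIso_π (h : IsResolution P ε) : QuasiIso h.π := by
  rw [quasiIso_iff]
  intro i
  obtain hi | rfl | hi := lt_trichotomy i 0
  · rw [quasiIsoAt_iff_exactAt _ _
      (ShortComplex.exact_of_isZero_X₂ _ (h.isZero i hi))]
    exact HomologicalComplex.exactAt_single_obj _ _ _ _ hi.ne
  · rw [quasiIsoAt_iff' _ 1 0 (-1) (by simp) (by simp), ShortComplex.quasiIso_iff_of_zeros']
    · have hπ : h.π.f 0 = ε ≫ (HomologicalComplex.singleObjXSelf (ComplexShape.down ℤ) 0 M).inv :=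
        HomologicalComplex.mkHomToSingle_f _ _
      constructor
      · rw [ShortComplex.moduleCat_exact_iff]
        intro x hx
        change h.π.f 0 x = 0 at hx
        refine (h.exact_zero x).1 ?_
        have h0 : ε = h.π.f 0 ≫ (HomologicalComplex.singleObjXSelf (ComplexShape.down ℤ) 0 M).hom := by
          rw [hπ, Category.assoc, Iso.inv_hom_id, Category.comp_id]
        exact (ConcreteCategory.congr_hom h0 x).trans ((congrArg
          (HomologicalComplex.singleObjXSelf (ComplexShape.down ℤ) 0 M).hom hx).trans (map_zero _))
      · change Epi (h.π.f 0)
        rw [hπ]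
        have := (ModuleCat.epi_iff_surjective _).2 h.surjective
        exact epi_comp _ _
    · exact (h.isZero (-1) (by simp)).eq_of_tgt _ _
    · exact HomologicalComplex.single_obj_d (ComplexShape.down ℤ) _ _ _ _
    · exact HomologicalComplex.single_obj_d (ComplexShape.down ℤ) _ _ _ _
  · rw [quasiIsoAt_iff_exactAt _ _ (h.exactAt i hi)]
    exact HomologicalComplex.exactAt_single_obj _ _ _ _ hi.ne'

end IsResolution

theorem isResolution_nonnegPart {M : ModuleCat.{u} R} {T : ChainComplex (ModuleCat.{u} R) ℤ}
    (hT : IsTotallyFlatAcyclic T) (ε : T.X 0 ⟶ M) (hs : Function.Surjective ε)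
    (he : Function.Exact (T.d 1 0) ε) :
    IsResolution (M := M) (nonnegPart T) ε where
  projective
    | Int.ofNat n => hT.projective _
    | Int.negSucc _ => (ModuleCat.isZero_of_subsingleton (ModuleCat.of R PUnit)).projective
  isZero
    | Int.ofNat n, h => by simp at h; lia
    | Int.negSucc _, _ => ModuleCat.isZero_of_subsingleton (ModuleCat.of R PUnit)
  surjective := hs
  exact_zero := he
  exactAt
    | Int.ofNat 0, h => by simp at h
    | Int.ofNat (n + 1), _ => by
      rw [exactAt_iff_forall (nonnegPart T) (c := .down ℤ) (i := Int.ofNat (n + 2))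
        (j := Int.ofNat (n + 1)) (k := Int.ofNat n) rfl rfl]
      exact hT.exists_d_apply_eq (i := Int.ofNat (n + 2)) (j := Int.ofNat (n + 1))
        (k := Int.ofNat n) rfl rfl
    | Int.negSucc _, h => absurd h (by simp)

/-! ### Lifting to resolutions and extending to negative degrees -/

/-- Dependent choice along the natural numbers. -/
theorem exists_seq {X : ℕ → Type u} (S : ∀ n, X n → X (n + 1) → Prop)
    (Q : ∀ n, X n → Prop) (a₀ : X 0) (h₀ : Q 0 a₀)
    (step : ∀ n a, Q n a → ∃ b, S n a b ∧ Q (n + 1) b) :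
    ∃ a : ∀ n, X n, a 0 = a₀ ∧ ∀ n, S n (a n) (a (n + 1)) := by
  choose b hb using step
  let s : ∀ n, {a : X n // Q n a} := fun n => Nat.rec ⟨a₀, h₀⟩
    (fun n a => ⟨b n a.1 a.2, (hb n a.1 a.2).2⟩) n
  exact ⟨fun n => (s n).1, rfl, fun n => (hb n (s n).1 (s n).2).1⟩

/-- The comparison theorem for projective resolutions. -/
theorem IsResolution.exists_lift {M N : ModuleCat.{u} R} {P Q : ChainComplex (ModuleCat.{u} R) ℤ}
    {ε : P.X 0 ⟶ M} {η : Q.X 0 ⟶ N} (hP : IsResolution P ε) (hQ : IsResolution Q η)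
    (f : M ⟶ N) : ∃ φ : P ⟶ Q, φ.f 0 ≫ η = ε ≫ f := by
  have := hP.projective 0
  have : Epi η := (ModuleCat.epi_iff_surjective _).2 hQ.surjective
  have lift : ∀ {A B C D : ModuleCat.{u} R} [Projective A] (g : A ⟶ C) (p : B ⟶ C) (q : C ⟶ D),
      Function.Exact p q → g ≫ q = 0 → ∃ g' : A ⟶ B, g' ≫ p = g := by
    intro A B C D _ g p q hpq hg
    have w : p ≫ q = 0 := by ext x; exact hpq.apply_apply_eq_zero x
    have h : (ShortComplex.mk p q w).Exact :=
      (ShortComplex.ShortExact.moduleCat_exact_iff_function_exact _).2 hpq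
    exact ⟨h.liftFromProjective g hg, h.liftFromProjective_comp g hg⟩
  have hex : ∀ n : ℕ, Function.Exact (Q.d (Int.ofNat (n + 2)) (Int.ofNat (n + 1)))
      (Q.d (Int.ofNat (n + 1)) (Int.ofNat n)) := fun n x =>
    ⟨(exactAt_iff_forall Q (c := .down ℤ) (i := Int.ofNat (n + 2))
        (j := Int.ofNat (n + 1)) (k := Int.ofNat n) rfl rfl).1 (hQ.exactAt (Int.ofNat (n + 1)) (by simp)) x, by
      rintro ⟨y, rfl⟩; exact d_d_apply Q _ _ _ y⟩
  have h0 : Projective.factorThru (ε ≫ f) η ≫ η = ε ≫ f := Projective.factorThru_comp _ _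
  set φ₀ := Projective.factorThru (ε ≫ f) η
  have := hP.projective 1
  obtain ⟨φ₁, h1⟩ := lift (P.d 1 0 ≫ φ₀) _ _ hQ.exact_zero (by
    rw [Category.assoc, h0, ← Category.assoc, hP.d_comp, zero_comp])
  -- A state is a pair of consecutive components, so that their commuting square is a condition on a
  -- single state.
  obtain ⟨a, ha, hs⟩ := exists_seq
    (X := fun n => (P.X (Int.ofNat n) ⟶ Q.X (Int.ofNat n)) ×
      (P.X (Int.ofNat (n + 1)) ⟶ Q.X (Int.ofNat (n + 1))))
    (fun n a b => a.2 = b.1 ∧ a.2 ≫ Q.d (Int.ofNat (n + 1)) (Int.ofNat n) =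
      P.d (Int.ofNat (n + 1)) (Int.ofNat n) ≫ a.1)
    (fun n a => a.2 ≫ Q.d (Int.ofNat (n + 1)) (Int.ofNat n) =
      P.d (Int.ofNat (n + 1)) (Int.ofNat n) ≫ a.1) ⟨φ₀, φ₁⟩ h1 (by
      rintro n ⟨a, b⟩ h
      have := hP.projective (Int.ofNat (n + 2))
      obtain ⟨c, hc⟩ := lift (P.d (Int.ofNat (n + 2)) (Int.ofNat (n + 1)) ≫ b) _ _ (hex n) (by
        rw [Category.assoc]
        refine (congrArg _ h).trans ?_
        rw [← Category.assoc, P.d_comp_d, zero_comp])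
      exact ⟨⟨b, c⟩, ⟨rfl, h⟩, hc⟩)
  refine ⟨homOfNat (fun n => (a n).1) (fun _ => 0) (fun n => ?_) ?_ (fun n => ?_), ?_⟩
  · rw [← (hs n).1]; exact (hs n).2
  · exact (hQ.isZero (Int.negSucc 0) (by simp)).eq_of_tgt _ _
  · rw [zero_comp, comp_zero]
  · change (a 0).1 ≫ η = _
    rw [ha]; exact h0

/-- A morphism defined on the nonnegative part of a totally acyclic complex, with values in a
complex of flat modules, extends to negative degrees. -/
theorem IsTotallyFlatAcyclic.exists_extension {T D : ChainComplex (ModuleCat.{u} R) ℤ}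
    (hT : IsTotallyFlatAcyclic T) (hD : ∀ n, IsFlat R (D.X n)) (p : T ⟶ nonnegPart D) :
    ∃ ψ : T ⟶ D, ψ ≫ toNonnegPart D = p := by
  let p' : ∀ n : ℕ, T.X (Int.ofNat n) ⟶ D.X (Int.ofNat n) := fun n => p.f (Int.ofNat n)
  have hp' : ∀ n : ℕ, p' (n + 1) ≫ D.d (Int.ofNat (n + 1)) (Int.ofNat n) =
      T.d (Int.ofNat (n + 1)) (Int.ofNat n) ≫ p' n :=
    fun n => p.comm (Int.ofNat (n + 1)) (Int.ofNat n)
  -- The composite `T₀ → D₀ → D₋₁` kills boundaries; as `D₋₁` is flat, it factors through `T₀ →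
  -- T₋₁`.
  obtain ⟨q, hq⟩ := hT.exists_d_comp_eq (i := 1) (j := 0) (k := -1) rfl rfl (hD (-1))
    (p' 0 ≫ D.d 0 (-1)) (by
      refine (Category.assoc _ _ _).symm.trans ?_
      refine (congrArg (· ≫ D.d 0 (-1)) (hp' 0).symm).trans ?_
      exact (Category.assoc _ _ _).trans ((congrArg _ (D.d_comp_d _ _ _)).trans comp_zero))
  obtain ⟨q1, hq1⟩ := hT.exists_d_comp_eq (i := 0) (j := -1) (k := -2) rfl rfl (hD (-2))
    (q ≫ D.d (-1) (-2)) (by rw [← Category.assoc, hq, Category.assoc, D.d_comp_d, comp_zero])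
  obtain ⟨a, ha, hs⟩ := exists_seq
    (X := fun n => (T.X (Int.negSucc n) ⟶ D.X (Int.negSucc n)) ×
      (T.X (Int.negSucc (n + 1)) ⟶ D.X (Int.negSucc (n + 1))))
    (fun n a b => a.2 = b.1 ∧ T.d (Int.negSucc n) (Int.negSucc (n + 1)) ≫ a.2 =
      a.1 ≫ D.d (Int.negSucc n) (Int.negSucc (n + 1)))
    (fun n a => T.d (Int.negSucc n) (Int.negSucc (n + 1)) ≫ a.2 =
      a.1 ≫ D.d (Int.negSucc n) (Int.negSucc (n + 1))) ⟨q, q1⟩ hq1 (by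
      rintro n ⟨a, b⟩ h
      obtain ⟨c, hc⟩ := hT.exists_d_comp_eq (i := Int.negSucc n) (j := Int.negSucc (n + 1))
        (k := Int.negSucc (n + 2)) rfl rfl (hD _)
        (b ≫ D.d (Int.negSucc (n + 1)) (Int.negSucc (n + 2))) (by
          rw [← Category.assoc]
          refine (congrArg (· ≫ _) h).trans ?_
          rw [Category.assoc, D.d_comp_d, comp_zero])
      exact ⟨⟨b, c⟩, ⟨rfl, h⟩, hc⟩)
  refine ⟨homOfNat p' (fun n => (a n).1) hp' ?_ (fun n => ?_), ?_⟩
  · rw [ha]; exact hq.symm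
  · rw [← (hs n).1]; exact (hs n).2.symm
  · ext i : 1
    match i with
    | Int.ofNat n => exact Category.comp_id _
    | Int.negSucc n =>
      exact (ModuleCat.isZero_of_subsingleton (ModuleCat.of R PUnit)).eq_of_tgt _ _

/-! ### Cones as resolutions of cokernels -/

section ConeResolution

open HomologicalComplex homotopyCofiber

variable {L M N : ModuleCat.{u} R} {P Q : ChainComplex (ModuleCat.{u} R) ℤ}
  {ε : P.X 0 ⟶ L} {η : Q.X 0 ⟶ M}

/-- The mapping cone of a lift of an injective homomorphism `L → M` to projective resolutions is a
projective resolution of its cokernel. -/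
theorem IsResolution.cofiber (hP : IsResolution P ε) (hQ : IsResolution Q η) {f : L ⟶ M}
    {g : M ⟶ N} (hf : Function.Injective f) (hfg : Function.Exact f g)
    (hg : Function.Surjective g) (φ : P ⟶ Q) (hφ : φ.f 0 ≫ η = ε ≫ f) :
    IsResolution (homotopyCofiber φ) (sndX φ 0 ≫ η ≫ g) := by
  have r₂₁ : (ComplexShape.down ℤ).Rel 2 1 := rfl
  have r₁₀ : (ComplexShape.down ℤ).Rel 1 0 := rfl
  have r₀ : (ComplexShape.down ℤ).Rel 0 (-1) := rfl
  have hφx : ∀ a, η (φ.f 0 a) = f (ε a) := fun a => ConcreteCategory.congr_hom hφ a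
  have hsnd : ∀ a b, sndX φ 0 (inlX φ (-1) 0 r₀ a + inrX φ 0 b) = b := by
    intro a b
    simp [← ConcreteCategory.comp_apply]
  have hP₀ : ∀ a : P.X (-1), a = 0 := fun a =>
    (ModuleCat.isZero_iff_subsingleton.1 (hP.isZero (-1) (by simp))).elim _ _
  refine ⟨cofiber_projective φ hP.projective hQ.projective, fun n hn => ?_, ?_, ?_, ?_⟩
  · exact isZero_X φ n (hQ.isZero n hn) (fun j hj => hP.isZero j (by
      simp only [ComplexShape.down_Rel] at hj; lia))
  · intro x
    obtain ⟨y, rfl⟩ := hg x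
    obtain ⟨z, rfl⟩ := hQ.surjective y
    exact ⟨inlX φ (-1) 0 r₀ 0 + inrX φ 0 z, congrArg g (congrArg η (hsnd 0 z))⟩
  · intro x
    constructor
    · intro hx
      obtain ⟨a, b, rfl⟩ := cofiber_exists_eq φ r₀ x
      have hx' : g (η b) = 0 := (congrArg g (congrArg η (hsnd a b))).symm.trans hx
      obtain ⟨l, hl⟩ := (hfg _).1 hx'
      obtain ⟨p, rfl⟩ := hP.surjective l
      obtain ⟨q, hq⟩ := (hQ.exact_zero (b - φ.f 0 p)).1 (by rw [map_sub, hφx, hl, sub_self])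
      refine ⟨inlX φ 0 1 r₁₀ p + inrX φ 1 q, ?_⟩
      rw [cofiber_d_apply φ r₁₀ r₀, hq, hP₀ a, hP₀ (-_)]
      simp
    · rintro ⟨y, rfl⟩
      obtain ⟨a, b, rfl⟩ := cofiber_exists_eq φ r₁₀ y
      rw [cofiber_d_apply φ r₁₀ r₀]
      refine (congrArg g (congrArg η (hsnd _ _))).trans ?_
      rw [map_add, hφx, hQ.exact_zero.apply_apply_eq_zero, add_zero, hfg.apply_apply_eq_zero]
  · intro n hn
    obtain rfl | hn := (show n = 1 ∨ 1 < n by lia)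
    · rw [exactAt_iff_forall (homotopyCofiber φ) r₂₁ r₁₀]
      intro x hx
      obtain ⟨a, b, rfl⟩ := cofiber_exists_eq φ r₁₀ x
      rw [cofiber_d_apply φ r₁₀ r₀] at hx
      have hab := (cofiber_eq_zero φ r₀ hx).2
      -- Injectivity of `f` enters here: the first homology of the cone is the kernel of `f`.
      have ha : ε a = 0 := hf (by
        have := congrArg η hab
        rw [map_add, hφx, hQ.exact_zero.apply_apply_eq_zero, add_zero, map_zero] at this
        rw [this, map_zero])
      obtain ⟨p, rfl⟩ := (hP.exact_zero a).1 ha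
      obtain ⟨q, hq⟩ := (exactAt_iff_forall Q r₂₁ r₁₀).1 (hQ.exactAt 1 (by simp)) (b + φ.f 1 p)
        (by rw [map_add, ← hom_d_apply, add_comm, hab])
      refine ⟨inlX φ 1 2 r₂₁ (-p) + inrX φ 2 q, ?_⟩
      rw [cofiber_d_apply φ r₂₁ r₁₀, hq]
      simp
    · have h0 : (ComplexShape.down ℤ).Rel (n + 1) n := rfl
      have h1 : (ComplexShape.down ℤ).Rel n (n - 1) := sub_add_cancel _ _
      have h2 : (ComplexShape.down ℤ).Rel (n - 1) (n - 1 - 1) := sub_add_cancel _ _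
      rw [exactAt_iff_forall (homotopyCofiber φ) h0 h1]
      exact cofiber_exists_d_apply_eq φ h0 h1 h2
        ((exactAt_iff_forall P h1 h2).1 (hP.exactAt (n - 1) (by lia)))
        ((exactAt_iff_forall Q h0 h1).1 (hQ.exactAt n (by lia)))

end ConeResolution

/-! ### From Ding projective resolutions to complete resolutions -/

/-- The module `M` has an `𝓕`-complete resolution `T ⟶ P ⟶ M` with `P` a projective resolution and
`T ⟶ P` bijective in degrees at least `n`. -/
def HasCompleteResolution (n : ℤ) (M : ModuleCat.{u} R) : Prop :=
  ∃ (T P : ChainComplex (ModuleCat.{u} R) ℤ) (τ : T ⟶ P) (ε : P.X 0 ⟶ M),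
    IsTotallyFlatAcyclic T ∧ IsResolution P ε ∧ ∀ i ≥ n, Function.Bijective (τ.f i)

theorem toNonnegPart_bijective (T : ChainComplex (ModuleCat.{u} R) ℤ) :
    ∀ i ≥ 0, Function.Bijective ((toNonnegPart T).f i)
  | Int.ofNat _, _ => Function.bijective_id
  | Int.negSucc _, h => absurd h (by simp)

theorem IsDingProjective.hasCompleteResolution {M : ModuleCat.{u} R} (hM : IsDingProjective M) :
    HasCompleteResolution 0 M := by
  obtain ⟨T, hT, ε, hs, he⟩ := (isDingProjective_iff M).1 hM
  exact ⟨T, nonnegPart T, toNonnegPart T, ε, hT, isResolution_nonnegPart hT ε hs he,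
    toNonnegPart_bijective T⟩

/-- The cone of the lift `φ : P ⟶ Q` resolves `M`, and the cone of its extension `ψ : T ⟶ T'` is
totally acyclic. The condition `0 ≤ n` keeps the degrees within the range where `T'` agrees with its
truncation. -/
theorem HasCompleteResolution.step {K G M : ModuleCat.{u} R} {n : ℤ} (hn : 0 ≤ n)
    (hK : HasCompleteResolution n K) (hG : IsDingProjective G) (f : K ⟶ G) (g : G ⟶ M)
    (hf : Function.Injective f) (hfg : Function.Exact f g) (hg : Function.Surjective g) :
    HasCompleteResolution (n + 1) M := by
  obtain ⟨T, P, τ, ε, hT, hP, hτ⟩ := hK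
  obtain ⟨T', hT', η, hs, he⟩ := (isDingProjective_iff G).1 hG
  have hQ := isResolution_nonnegPart hT' η hs he
  obtain ⟨φ, hφ⟩ := hP.exists_lift hQ f
  obtain ⟨ψ, hψ⟩ := hT.exists_extension
    (fun n => have := hT'.projective n; isFlat_of_projective_obj _) (τ ≫ φ)
  refine ⟨_, _, cofiberMap ψ φ τ (toNonnegPart T') hψ.symm, _,
    cofiber_isTotallyFlatAcyclic ψ hT hT', hP.cofiber hQ hf hfg hg φ hφ, fun i hi => ?_⟩
  exact cofiberMap_bijective _ _ _ _ _ (sub_add_cancel i 1) (hτ _ (by lia))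
    (toNonnegPart_bijective T' i (by lia))

/-- A resolution of length `n` by Ding projective modules yields an `𝓕`-complete resolution with
comparison map bijective in degrees at least `n`. -/
theorem DingResolution.hasCompleteResolution {n : ℕ} : ∀ {M : ModuleCat.{u} R}
    (_ : DingResolution M n), HasCompleteResolution n M := by
  induction n with
  | zero =>
    intro M D
    have hinj : Function.Injective D.ε := by
      rw [injective_iff_map_eq_zero]
      intro x hx
      obtain ⟨y, rfl⟩ := (D.exact_zero x).1 hx
      have := ModuleCat.isZero_iff_subsingleton.1 (D.isZero 1 (by simp))
      rw [Subsingleton.elim y 0, map_zero]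
    have hε : Function.Exact (0 : D.G 0 ⟶ D.G 0) D.ε := fun x =>
      ⟨fun hx => ⟨0, by rw [map_zero]; exact (hinj (hx.trans (map_zero _).symm)).symm⟩, by
        rintro ⟨y, rfl⟩; exact map_zero _⟩
    obtain ⟨T, hT, η, hs, he⟩ := (isDingProjective_iff _).1 (D.dingProjective 0 le_rfl)
    refine IsDingProjective.hasCompleteResolution ((isDingProjective_iff M).2
      ⟨T, hT, η ≫ D.ε, D.surjective_ε.comp hs, fun x => ?_⟩)
    rw [← he x]
    exact ⟨fun h => hinj (h.trans (map_zero _).symm), fun h => (congrArg D.ε h).trans (map_zero _)⟩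
  | succ n ih =>
    intro M D
    let K : ModuleCat.{u} R := ModuleCat.of R (LinearMap.ker D.ε.hom)
    let p : D.G 1 ⟶ K := ModuleCat.ofHom ((D.d 0).hom.codRestrict _
      (fun x => D.exact_zero.apply_apply_eq_zero x))
    let D' : DingResolution K n :=
      { G := fun i => D.G (i + 1)
        d := fun i => D.d (i + 1)
        ε := p
        dingProjective := fun i hi => D.dingProjective _ (by lia)
        isZero := fun i hi => D.isZero _ (by lia)
        surjective_ε := by
          rintro ⟨x, hx⟩
          obtain ⟨y, rfl⟩ := (D.exact_zero x).1 hx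
          exact ⟨y, rfl⟩
        exact_zero := fun x => by
          rw [← D.exact_succ 0 x]
          exact Subtype.ext_iff
        exact_succ := fun i => D.exact_succ (i + 1) }
    have h := (ih D').step (Int.natCast_nonneg n) (D.dingProjective 0 (by simp))
      (ModuleCat.ofHom (LinearMap.ker D.ε.hom).subtype) D.ε Subtype.val_injective
      (fun x => by simp [K]) D.surjective_ε
    exact_mod_cast h

theorem HasCompleteResolution.exists_completeResolution {n : ℤ} {M : ModuleCat.{u} R}
    (h : HasCompleteResolution n M) :
    ∃ C : CompleteResolution (sphere M), ∀ i ≥ n, Function.Bijective (C.τ.f i) := by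
  obtain ⟨T, P, τ, ε, hT, hP, hτ⟩ := h
  exact ⟨⟨T, P, τ, hP.π, hT, hP.isDGProjective, hP.quasiIso_π, n, hτ⟩, hτ⟩

/-! ### Constructing Ding projective modules and their resolutions -/

/-- The complex `⋯ ⟶ Q × Q ⟶ Q × Q ⟶ ⋯` with all differentials `(x, y) ↦ (y, 0)`. -/
def squareZeroComplex (Q : ModuleCat.{u} R) : ChainComplex (ModuleCat.{u} R) ℤ where
  X _ := ModuleCat.of R (Q × Q)
  d i j := if j + 1 = i then ModuleCat.ofHom (LinearMap.inl R Q Q ∘ₗ LinearMap.snd R Q Q) else 0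
  shape i j hij := if_neg hij
  d_comp_d' i j k hij hjk := by
    rw [if_pos (show j + 1 = i from hij), if_pos (show k + 1 = j from hjk)]
    ext x <;> simp

theorem squareZeroComplex_d_apply (Q : ModuleCat.{u} R) {i j : ℤ} (hij : j + 1 = i) (x : Q × Q) :
    (squareZeroComplex Q).d i j x = ((x.2, 0) : Q × Q) := by
  simp only [squareZeroComplex, if_pos hij]
  rfl

/-- The map `(x, y) ↦ (0, x)` is a contracting homotopy, so `Hom` into any module is exact; it
provides both witnesses below. -/
theorem squareZeroComplex_isTotallyFlatAcyclic (Q : ModuleCat.{u} R) [Projective Q] :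
    IsTotallyFlatAcyclic (squareZeroComplex Q) := by
  refine .of_exists (fun n => ?_) (fun n x hx => ?_) (fun F _ n g hg => ?_)
  · have : Module.Projective R Q := (IsProjective.iff_projective (R := R) Q).2 inferInstance
    exact (IsProjective.iff_projective (R := R) (Q × Q)).1 inferInstance
  · have h : ((x.2, 0) : Q × Q) = 0 :=
      (squareZeroComplex_d_apply Q (sub_add_cancel n 1) x).symm.trans hx
    refine ⟨((0, x.1) : Q × Q), (squareZeroComplex_d_apply Q rfl _).trans ?_⟩
    exact Prod.ext rfl (Prod.ext_iff.1 h).1.symm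
  · refine ⟨ModuleCat.ofHom (g.hom ∘ₗ LinearMap.inr R Q Q ∘ₗ LinearMap.fst R Q Q), ?_⟩
    ext x
    have h1 : g ((x.1, 0) : Q × Q) = 0 :=
      (congrArg g (squareZeroComplex_d_apply Q (i := n + 1) rfl ((0, x.1) : Q × Q))).symm.trans
        (ConcreteCategory.congr_hom hg _)
    have h2 : x = ((x.1, 0) : Q × Q) + ((0, x.2) : Q × Q) :=
      Prod.ext (add_zero _).symm (zero_add _).symm
    refine (congrArg (fun y : Q × Q => g ((0, y.1) : Q × Q))
      (squareZeroComplex_d_apply Q (sub_add_cancel n 1) x)).trans ?_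
    conv_rhs => rw [h2]
    exact ((g.hom.map_add _ _).trans ((congrArg (· + _) h1).trans (zero_add _))).symm

theorem isDingProjective_of_projective (Q : ModuleCat.{u} R) [Projective Q] :
    IsDingProjective Q := by
  refine (isDingProjective_iff Q).2 ⟨squareZeroComplex Q, squareZeroComplex_isTotallyFlatAcyclic Q,
    ModuleCat.ofHom (LinearMap.snd R Q Q), fun x => ⟨((0, x) : Q × Q), rfl⟩, fun x => ?_⟩
  constructor
  · intro hx
    refine ⟨((0, x.1) : Q × Q), (squareZeroComplex_d_apply Q rfl _).trans ?_⟩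
    exact Prod.ext rfl hx.symm
  · rintro ⟨y, rfl⟩
    exact congrArg Prod.snd (squareZeroComplex_d_apply Q (zero_add 1) y)

/-- The complex `T` with degrees shifted by `k`. -/
def degreeShift (T : ChainComplex (ModuleCat.{u} R) ℤ) (k : ℤ) :
    ChainComplex (ModuleCat.{u} R) ℤ where
  X i := T.X (i + k)
  d i j := T.d (i + k) (j + k)
  shape i j hij := T.shape _ _ (fun h => hij (by simp only [ComplexShape.down_Rel] at h ⊢; lia))
  d_comp_d' _ _ _ _ _ := T.d_comp_d _ _ _

theorem IsTotallyFlatAcyclic.degreeShift {T : ChainComplex (ModuleCat.{u} R) ℤ}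
    (hT : IsTotallyFlatAcyclic T) (k : ℤ) : IsTotallyFlatAcyclic (degreeShift T k) :=
  .of_exists (fun n => hT.projective (n + k))
    (fun n => hT.exists_d_apply_eq (i := n + 1 + k) (j := n + k) (k := n - 1 + k)
      (by lia) (by lia))
    (fun _ hF n => hT.exists_d_comp_eq (i := n + 1 + k) (j := n + k) (k := n - 1 + k)
      (by lia) (by lia) hF)

theorem IsTotallyFlatAcyclic.isDingProjective {T : ChainComplex (ModuleCat.{u} R) ℤ}
    (hT : IsTotallyFlatAcyclic T) {M : ModuleCat.{u} R} {i j : ℤ} (hij : j + 1 = i)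
    (ε : T.X j ⟶ M) (hs : Function.Surjective ε) (he : Function.Exact (T.d i j) ε) :
    IsDingProjective M := by
  obtain ⟨k, rfl⟩ : ∃ k, j = 0 + k := ⟨j, (zero_add j).symm⟩
  obtain rfl : i = 1 + k := by lia
  exact (isDingProjective_iff M).2 ⟨_, hT.degreeShift k, ε, hs, he⟩

/-- A Ding projective module is a Ding projective resolution of itself. -/
def IsDingProjective.resolution {M : ModuleCat.{u} R} (hM : IsDingProjective M) :
    DingResolution M 0 where
  G
    | 0 => M
    | _ + 1 => ModuleCat.of R PUnit
  d _ := 0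
  ε := 𝟙 M
  dingProjective
    | 0, _ => hM
    | _ + 1, h => absurd h (by simp)
  isZero
    | 0, h => absurd h (by simp)
    | _ + 1, _ => ModuleCat.isZero_of_subsingleton (ModuleCat.of R PUnit)
  surjective_ε := Function.surjective_id
  exact_zero x := ⟨fun h => ⟨0, h.symm⟩, by rintro ⟨y, rfl⟩; rfl⟩
  exact_succ i x := ⟨fun _ => ⟨0, rfl⟩, fun _ => rfl⟩

/-- Splicing a Ding projective resolution with a short exact sequence. -/
def DingResolution.cons {K G M : ModuleCat.{u} R} {n : ℕ} (D : DingResolution K n)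
    (hG : IsDingProjective G) (f : K ⟶ G) (g : G ⟶ M)
    (hf : Function.Injective f) (hfg : Function.Exact f g) (hg : Function.Surjective g) :
    DingResolution M (n + 1) where
  G
    | 0 => G
    | i + 1 => D.G i
  d
    | 0 => D.ε ≫ f
    | i + 1 => D.d i
  ε := g
  dingProjective
    | 0, _ => hG
    | i + 1, h => D.dingProjective i (by lia)
  isZero
    | 0, h => absurd h (by simp)
    | i + 1, h => D.isZero i (by lia)
  surjective_ε := hg
  exact_zero x := by
    rw [hfg x]
    constructor
    · rintro ⟨y, rfl⟩
      obtain ⟨z, rfl⟩ := D.surjective_ε y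
      exact ⟨z, rfl⟩
    · rintro ⟨z, rfl⟩
      exact ⟨D.ε z, rfl⟩
  exact_succ
    | 0, x => by
      rw [← D.exact_zero x]
      exact ⟨fun h => hf (h.trans (map_zero f.hom).symm),
        fun h => (congrArg f h).trans (map_zero f.hom)⟩
    | i + 1, x => D.exact_succ i x

/-! ### DG-projective complexes exact in negative degrees -/

section Boundaries

variable (P : ChainComplex (ModuleCat.{u} R) ℤ)

/-- The module of boundaries in degree `-1`. -/
abbrev boundaries : ModuleCat.{u} R := ModuleCat.of R (LinearMap.range (P.d 0 (-1)).hom)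

/-- The differential, as a map onto the boundaries in degree `-1`. -/
def toBoundaries : P.X 0 ⟶ boundaries P := ModuleCat.ofHom (P.d 0 (-1)).hom.rangeRestrict

/-- The inclusion of the boundaries in degree `-1`. -/
def boundariesι : boundaries P ⟶ P.X (-1) :=
  ModuleCat.ofHom (LinearMap.range (P.d 0 (-1)).hom).subtype

theorem toBoundaries_ι : toBoundaries P ≫ boundariesι P = P.d 0 (-1) := rfl

theorem toBoundaries_surjective : Function.Surjective (toBoundaries P) :=
  LinearMap.surjective_rangeRestrict _

theorem boundariesι_injective : Function.Injective (boundariesι P) := Subtype.val_injective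

theorem toBoundaries_eq_zero {x : P.X 0} : toBoundaries P x = 0 ↔ P.d 0 (-1) x = 0 :=
  Subtype.ext_iff

theorem d_toBoundaries : P.d 1 0 ≫ toBoundaries P = 0 := by
  ext x
  exact congrArg Subtype.val ((toBoundaries_eq_zero P).2 (d_d_apply P 1 0 (-1) x))

theorem boundariesι_d : boundariesι P ≫ P.d (-1) (-2) = 0 := by
  ext ⟨_, x, rfl⟩
  exact d_d_apply P 0 (-1) (-2) x

/-- The complex `⋯ ⟶ 0 ⟶ B ⟶ P₋₁ ⟶ P₋₂ ⟶ ⋯`, with `B` the module of boundaries in degree `-1`. -/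
def boundaryComplex : ChainComplex (ModuleCat.{u} R) ℤ where
  X
    | Int.ofNat 0 => boundaries P
    | Int.ofNat (_ + 1) => ModuleCat.of R PUnit
    | Int.negSucc n => P.X (Int.negSucc n)
  d
    | Int.ofNat 0, Int.negSucc 0 => boundariesι P
    | Int.negSucc m, Int.negSucc n => P.d (Int.negSucc m) (Int.negSucc n)
    | Int.ofNat 0, Int.negSucc (_ + 1) => 0
    | Int.ofNat (_ + 1), Int.negSucc _ => 0
    | Int.ofNat _, Int.ofNat _ => 0
    | Int.negSucc _, Int.ofNat _ => 0
  shape i j hij := by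
    match i, j with
    | Int.ofNat 0, Int.negSucc 0 => exact absurd rfl hij
    | Int.negSucc m, Int.negSucc n => exact P.shape _ _ hij
    | Int.ofNat 0, Int.negSucc (_ + 1) => rfl
    | Int.ofNat (_ + 1), Int.negSucc _ => rfl
    | Int.ofNat 0, Int.ofNat _ => rfl
    | Int.ofNat (_ + 1), Int.ofNat _ => rfl
    | Int.negSucc _, Int.ofNat _ => rfl
  d_comp_d' i j k hij hjk := by
    obtain rfl : k + 1 = j := hjk
    obtain rfl : k + 1 + 1 = i := hij
    match k with
    | Int.negSucc 0 => exact zero_comp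
    | Int.negSucc 1 => exact boundariesι_d P
    | Int.negSucc (n + 2) => exact P.d_comp_d _ _ _
    | Int.ofNat _ => exact comp_zero

/-- The projection of a complex onto its boundary complex. -/
def toBoundaryComplex : P ⟶ boundaryComplex P :=
  homOfNat
    (fun n => match n with
      | 0 => toBoundaries P
      | _ + 1 => 0)
    (fun _ => 𝟙 _)
    (fun n => match n with
      | 0 => zero_comp.trans (d_toBoundaries P).symm
      | _ + 1 => zero_comp.trans comp_zero.symm)
    ((toBoundaries_ι P).trans (Category.comp_id _).symm)
    (fun _ => (Category.id_comp _).trans (Category.comp_id _).symm)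

theorem boundaryComplex_acyclic (hP : ∀ i < 0, P.ExactAt i) : (boundaryComplex P).Acyclic
  | Int.ofNat (_ + 1) => ShortComplex.exact_of_isZero_X₂ _
      (ModuleCat.isZero_of_subsingleton (ModuleCat.of R PUnit))
  | Int.ofNat 0 => by
    rw [exactAt_iff_forall (boundaryComplex P) (c := .down ℤ) (i := Int.ofNat 1) (j := Int.ofNat 0)
      (k := Int.negSucc 0) rfl rfl]
    exact fun x hx => ⟨0, (map_zero _).trans
      (boundariesι_injective P (hx.trans (map_zero _).symm)).symm⟩
  | Int.negSucc 0 => by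
    rw [exactAt_iff_forall (boundaryComplex P) (c := .down ℤ) (i := Int.ofNat 0)
      (j := Int.negSucc 0) (k := Int.negSucc 1) rfl rfl]
    intro x hx
    obtain ⟨y, hy⟩ := (exactAt_iff_forall P (c := .down ℤ) (i := 0)
      (j := -1) (k := -2) rfl (by simp)).1 (hP (-1) (by simp)) x hx
    exact ⟨toBoundaries P y, hy⟩
  | Int.negSucc (n + 1) => by
    rw [exactAt_iff_forall (boundaryComplex P) (c := .down ℤ) (i := Int.negSucc n)
      (j := Int.negSucc (n + 1)) (k := Int.negSucc (n + 2)) rfl rfl]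
    exact (exactAt_iff_forall P (c := .down ℤ) (i := Int.negSucc n)
      (j := Int.negSucc (n + 1)) (k := Int.negSucc (n + 2)) rfl rfl).1 (hP _ (by simp))

variable {P}

/-- If a DG-projective complex is exact in negative degrees, then its boundaries in degree `-1`
form a direct summand. -/
theorem IsDGProjective.exists_retraction (h : IsDGProjective P) (hP : ∀ i < 0, P.ExactAt i) :
    ∃ s : P.X (-1) ⟶ boundaries P, boundariesι P ≫ s = 𝟙 _ := by
  let Φ := (ChainComplex.cochainComplexEquivalence (ModuleCat.{u} R)).functor
  have hE : (Φ.obj (boundaryComplex P)).Acyclic := by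
    intro i
    rw [exactAt_iff_forall (Φ.obj (boundaryComplex P)) (c := .up ℤ) (i := i - 1) (k := i + 1)
      (sub_add_cancel i 1) rfl]
    exact (exactAt_iff_forall (boundaryComplex P) (c := .down ℤ) (i := -(i - 1)) (j := -i)
      (k := -(i + 1)) (by simp only [ComplexShape.down_Rel]; lia)
      (by simp only [ComplexShape.down_Rel]; lia)).1
      (boundaryComplex_acyclic P hP (-i))
  have := h.isKProjective
  obtain ⟨H⟩ := CochainComplex.IsKProjective.nonempty_homotopy_zero
    (Φ.map (toBoundaryComplex P)) hE
  -- Cochain degree `1` is chain degree `-1`. The other homotopy component at degree `0` lands in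
  -- chain degree `1` of the boundary complex, which is zero.
  let s : P.X (-1) ⟶ boundaries P := H.hom 1 0
  have hz : H.hom 0 (-1) = 0 :=
    (ModuleCat.isZero_of_subsingleton (ModuleCat.of R PUnit)).eq_of_tgt _ _
  have hs : toBoundaries P = P.d 0 (-1) ≫ s := by
    have := H.comm 0
    rw [dNext_eq H.hom (i' := 1) (by simp), prevD_eq H.hom (j' := -1) (by simp), hz, zero_comp,
      add_zero, HomologicalComplex.zero_f, add_zero] at this
    exact this
  refine ⟨s, ?_⟩
  have : Epi (toBoundaries P) := (ModuleCat.epi_iff_surjective _).2 (toBoundaries_surjective P)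
  rw [← cancel_epi (toBoundaries P), ← Category.assoc, toBoundaries_ι, ← hs, Category.comp_id]

theorem IsDGProjective.projective_boundaries (h : IsDGProjective P)
    (hP : ∀ i < 0, P.ExactAt i) : Projective (boundaries P) := by
  obtain ⟨s, hs⟩ := h.exists_retraction hP
  have := h.projective (-1)
  exact Retract.projective ⟨boundariesι P, s, hs⟩

/-- The surjection of `P₀` onto the projective module of boundaries splits, and the cycles are its
kernel. -/
theorem IsDGProjective.projective_cycles (h : IsDGProjective P) (hP : ∀ i < 0, P.ExactAt i) :
    Projective (ModuleCat.of R (LinearMap.ker (P.d 0 (-1)).hom)) := by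
  have := h.projective_boundaries hP
  have := h.projective 0
  have : Epi (toBoundaries P) := (ModuleCat.epi_iff_surjective _).2 (toBoundaries_surjective P)
  let σ : boundaries P ⟶ P.X 0 := Projective.factorThru (𝟙 _) (toBoundaries P)
  have hσ : ∀ x, toBoundaries P (σ x) = x :=
    fun x => ConcreteCategory.congr_hom (Projective.factorThru_comp (𝟙 _) (toBoundaries P)) x
  let r : P.X 0 ⟶ ModuleCat.of R (LinearMap.ker (P.d 0 (-1)).hom) :=
    ModuleCat.ofHom ((𝟙 (P.X 0) - toBoundaries P ≫ σ).hom.codRestrict _ (fun x => by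
      refine (toBoundaries_eq_zero P).1 ?_
      change toBoundaries P (x - σ (toBoundaries P x)) = 0
      rw [map_sub, hσ, sub_self]))
  refine Retract.projective ⟨ModuleCat.ofHom (LinearMap.ker (P.d 0 (-1)).hom).subtype, r, ?_⟩
  ext x
  change x.1 - σ (toBoundaries P x.1) = x.1
  rw [(toBoundaries_eq_zero P).2 x.2, map_zero, sub_zero]

end Boundaries

/-! ### The augmentation induced by a quasi-isomorphism to a module -/

section Augmentation

variable {M : ModuleCat.{u} R} {P : ChainComplex (ModuleCat.{u} R) ℤ} (π : P ⟶ sphere M)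

/-- The degree zero component of a morphism to the complex `S⁰(M)`. -/
def augmentation : P.X 0 ⟶ M :=
  π.f 0 ≫ (HomologicalComplex.singleObjXSelf (ComplexShape.down ℤ) 0 M).hom

theorem d_augmentation : P.d 1 0 ≫ augmentation π = 0 := by
  rw [augmentation, ← π.comm_assoc, HomologicalComplex.single_obj_d, zero_comp, comp_zero]

theorem exactAt_of_quasiIso_sphere [QuasiIso π] (i : ℤ) (hi : i ≠ 0) : P.ExactAt i :=
  (exactAt_iff_of_quasiIsoAt π i).2 (HomologicalComplex.exactAt_single_obj _ _ _ _ hi)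

/-- This translates the isomorphism on `H₀` into statements about elements: on cycles, the
augmentation is onto `M` and its kernel consists of boundaries. -/
theorem homologyπ_augmentation : P.homologyπ 0 ≫ HomologicalComplex.homologyMap π 0 ≫
    (HomologicalComplex.singleObjHomologySelfIso (ComplexShape.down ℤ) 0 M).hom =
      P.iCycles 0 ≫ augmentation π := by
  rw [HomologicalComplex.homologyπ_naturality_assoc,
    HomologicalComplex.homologyπ_singleObjHomologySelfIso_hom,
    HomologicalComplex.singleObjCyclesSelfIso_hom, HomologicalComplex.cyclesMap_i_assoc]
  rfl

theorem exists_cycle_augmentation_eq [QuasiIso π] (m : M) :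
    ∃ z : P.X 0, P.d 0 (-1) z = 0 ∧ augmentation π z = m := by
  have : Epi (P.iCycles 0 ≫ augmentation π) := by
    rw [← homologyπ_augmentation]; infer_instance
  obtain ⟨y, hy⟩ := (ModuleCat.epi_iff_surjective _).1 this m
  exact ⟨P.iCycles 0 y, ConcreteCategory.congr_hom (P.iCycles_d 0 (-1)) y, hy⟩

theorem exists_d_eq_of_augmentation_eq_zero [QuasiIso π] (z : P.X 0) (hz : P.d 0 (-1) z = 0)
    (hz' : augmentation π z = 0) : ∃ y : P.X 1, P.d 1 0 y = z := by
  let ι : ModuleCat.of R (LinearMap.ker (P.d 0 (-1)).hom) ⟶ P.X 0 :=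
    ModuleCat.ofHom (LinearMap.ker (P.d 0 (-1)).hom).subtype
  have hι : ι ≫ P.d 0 (-1) = 0 := by
    ext x; exact x.2
  let c : P.cycles 0 := P.liftCycles ι (-1) (by simp) hι ⟨z, hz⟩
  have hc : P.iCycles 0 c = z :=
    ConcreteCategory.congr_hom (P.liftCycles_i ι (-1) (by simp) hι) ⟨z, hz⟩
  have h0 : P.homologyπ 0 c = 0 := by
    have hinj : Function.Injective (HomologicalComplex.homologyMap π 0 ≫
        (HomologicalComplex.singleObjHomologySelfIso (ComplexShape.down ℤ) 0 M).hom) :=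
      (ModuleCat.mono_iff_injective _).1 inferInstance
    refine hinj ?_
    rw [map_zero]
    refine (ConcreteCategory.congr_hom (homologyπ_augmentation π) c).trans ?_
    exact (congrArg (augmentation π) hc).trans hz'
  have hex : (ShortComplex.mk (P.toCycles 1 0) (P.homologyπ 0) (by simp)).Exact :=
    ShortComplex.exact_of_g_is_cokernel _ (P.homologyIsCokernel 1 0 (by simp))
  obtain ⟨y, hy⟩ := (ShortComplex.moduleCat_exact_iff _).1 hex c h0
  refine ⟨y, ?_⟩
  rw [← hc, ← hy]
  exact (ConcreteCategory.congr_hom (P.toCycles_i 1 0) y).symm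

end Augmentation

/-! ### Cokernels of the differentials as syzygies -/

section Cokernels

variable (P : ChainComplex (ModuleCat.{u} R) ℤ)

/-- The cokernel of the differential into degree `i`. -/
abbrev coker (i : ℤ) : ModuleCat.{u} R :=
  ModuleCat.of R (P.X i ⧸ LinearMap.range (P.d (i + 1) i).hom)

/-- The projection onto the cokernel of the differential into degree `i`. -/
def cokerπ (i : ℤ) : P.X i ⟶ coker P i := ModuleCat.ofHom (Submodule.mkQ _)

theorem cokerπ_surjective (i : ℤ) : Function.Surjective (cokerπ P i) :=
  Submodule.mkQ_surjective _

theorem cokerπ_eq_zero {i : ℤ} {x : P.X i} :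
    cokerπ P i x = 0 ↔ ∃ y : P.X (i + 1), P.d (i + 1) i y = x :=
  Submodule.Quotient.mk_eq_zero _

/-- A homomorphism out of `P i` that vanishes on boundaries descends to the cokernel. -/
theorem exists_cokerπ_comp_eq (i : ℤ) {A : ModuleCat.{u} R} (g : P.X i ⟶ A)
    (hg : P.d (i + 1) i ≫ g = 0) : ∃ f : coker P i ⟶ A, ∀ x, f (cokerπ P i x) = g x :=
  ⟨ModuleCat.ofHom (Submodule.liftQ _ g.hom (by
    rintro _ ⟨y, rfl⟩
    exact ConcreteCategory.congr_hom hg y)), fun _ => rfl⟩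

variable {P}

/-- Splices the sequences `0 → coker (i + 1) → P i → coker i → 0`. Injectivity on the left is
exactness of `P` at `i + 1`, whence `i ≥ 0`. -/
theorem nonempty_dingResolution_coker (hp : ∀ n, Projective (P.X n))
    (he : ∀ n > 0, P.ExactAt n) (m : ℕ) : ∀ i ≥ 0, IsDingProjective (coker P (i + m)) →
      Nonempty (DingResolution (coker P i) m) := by
  induction m with
  | zero =>
    intro i _ h
    rw [Nat.cast_zero, add_zero] at h
    exact ⟨h.resolution⟩
  | succ m ih =>
    intro i hi h
    obtain ⟨D⟩ := ih (i + 1) (by lia) (by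
      rwa [show i + 1 + (m : ℤ) = i + ((m + 1 : ℕ) : ℤ) by push_cast; ring])
    have := hp i
    obtain ⟨f, hf⟩ := exists_cokerπ_comp_eq P (i + 1) (P.d (i + 1) i) (P.d_comp_d _ _ _)
    refine ⟨D.cons (isDingProjective_of_projective (P.X i)) f (cokerπ P i) ?_ (fun x => ?_)
      (cokerπ_surjective P i)⟩
    · rw [injective_iff_map_eq_zero]
      intro a ha
      obtain ⟨x, rfl⟩ := cokerπ_surjective P _ a
      rw [hf] at ha
      exact (cokerπ_eq_zero P).2 ((exactAt_iff_forall P (c := .down ℤ) (i := i + 1 + 1)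
        (j := i + 1) (k := i) rfl rfl).1 (he _ (by lia)) x ha)
    · rw [cokerπ_eq_zero]
      constructor
      · rintro ⟨y, rfl⟩
        exact ⟨_, hf y⟩
      · rintro ⟨a, rfl⟩
        obtain ⟨y, rfl⟩ := cokerπ_surjective P _ a
        exact ⟨y, (hf y).symm⟩

/-- If `T ⟶ P` is bijective in degrees at least `n` and `T` is totally acyclic, then the cokernel
in degree `n` of `P` is Ding projective. -/
theorem isDingProjective_coker {T : ChainComplex (ModuleCat.{u} R) ℤ}
    (hT : IsTotallyFlatAcyclic T) (τ : T ⟶ P) {n : ℤ}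
    (hτ : ∀ i ≥ n, Function.Bijective (τ.f i)) : IsDingProjective (coker P n) := by
  refine hT.isDingProjective (i := n + 1) rfl (τ.f n ≫ cokerπ P n)
    ((cokerπ_surjective P n).comp (hτ n le_rfl).2) (fun x => ?_)
  refine (cokerπ_eq_zero P (x := τ.f n x)).trans ?_
  constructor
  · rintro ⟨y, hy⟩
    obtain ⟨z, rfl⟩ := (hτ (n + 1) (by lia)).2 y
    exact ⟨z, (hτ n le_rfl).1 ((hom_d_apply τ _ _ z).trans hy)⟩
  · rintro ⟨z, rfl⟩
    exact ⟨τ.f _ z, (hom_d_apply τ _ _ z).symm⟩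

end Cokernels

/-! ### Splitting a contractible summand off a totally acyclic complex -/

section Split

variable {T : ChainComplex (ModuleCat.{u} R) ℤ} {B : ModuleCat.{u} R}

/-- The projection of a complex `T` onto its summand `⋯ ⟶ 0 ⟶ B ⟶ B ⟶ 0 ⟶ ⋯` in degrees `0` and
`-1`, for `q : T₀ ⟶ B` with section `s` and extension `e` to `T₋₁`. -/
def diskProjection (q : T.X 0 ⟶ B) (s : B ⟶ T.X 0) (e : T.X (-1) ⟶ B)
    (hq : T.d 1 0 ≫ q = 0) (he : T.d 0 (-1) ≫ e = q) : T ⟶ T :=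
  homOfNat
    (fun n => match n with
      | 0 => q ≫ s
      | _ + 1 => 0)
    (fun n => match n with
      | 0 => e ≫ s ≫ T.d 0 (Int.negSucc 0)
      | _ + 1 => 0)
    (fun n => match n with
      | 0 => zero_comp.trans ((Category.assoc _ _ _).symm.trans
          ((congrArg (· ≫ s) hq).trans zero_comp)).symm
      | _ + 1 => zero_comp.trans comp_zero.symm)
    ((Category.assoc _ _ _).trans ((congrArg (· ≫ s ≫ T.d 0 (Int.negSucc 0)) he.symm).trans
      (Category.assoc _ _ _)))
    (fun n => match n with
      | 0 => (Category.assoc _ _ _).trans ((congrArg (e ≫ ·) ((Category.assoc _ _ _).trans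
          ((congrArg (s ≫ ·) (T.d_comp_d _ _ _)).trans comp_zero))).trans
            (comp_zero.trans comp_zero.symm))
      | _ + 1 => zero_comp.trans comp_zero.symm)

theorem diskProjection_idem (q : T.X 0 ⟶ B) (s : B ⟶ T.X 0) (e : T.X (-1) ⟶ B)
    (hq : T.d 1 0 ≫ q = 0) (he : T.d 0 (-1) ≫ e = q) (hs : s ≫ q = 𝟙 B) :
    diskProjection q s e hq he ≫ diskProjection q s e hq he = diskProjection q s e hq he := by
  ext i : 1
  match i with
  | Int.ofNat 0 =>
    change (q ≫ s) ≫ q ≫ s = q ≫ s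
    rw [Category.assoc, reassoc_of% hs]
  | Int.ofNat (_ + 1) => exact zero_comp
  | Int.negSucc 0 =>
    change (e ≫ s ≫ T.d 0 (-1)) ≫ e ≫ s ≫ T.d 0 (-1) = e ≫ s ≫ T.d 0 (-1)
    simp only [Category.assoc]
    rw [reassoc_of% he, reassoc_of% hs]
  | Int.negSucc (_ + 1) => exact zero_comp

/-- Removing a projective summand from a Ding projective module. -/
theorem IsTotallyFlatAcyclic.isDingProjective_of_split (hT : IsTotallyFlatAcyclic T)
    [Projective B] {M : ModuleCat.{u} R} (q : T.X 0 ⟶ B) (hq : T.d 1 0 ≫ q = 0)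
    (hqs : Function.Surjective q) (ε : T.X 0 ⟶ M) (hε : T.d 1 0 ≫ ε = 0)
    (hsurj : ∀ m, ∃ x, q x = 0 ∧ ε x = m)
    (hker : ∀ x, q x = 0 → ε x = 0 → ∃ y, T.d 1 0 y = x) : IsDingProjective M := by
  -- `B` is projective, hence flat, so `q` extends to `T₋₁`; this makes the summand a subcomplex `B
  -- = B` with a projection from `T`.
  obtain ⟨e, he⟩ := hT.exists_d_comp_eq (i := 1) (j := 0) (k := -1) rfl rfl
    (isFlat_of_projective_obj B) q hq
  have : Epi q := (ModuleCat.epi_iff_surjective _).2 hqs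
  let s : B ⟶ T.X 0 := Projective.factorThru (𝟙 B) q
  have hs : s ≫ q = 𝟙 B := Projective.factorThru_comp _ _
  let f := diskProjection q s e hq he
  have hf : f ≫ f = f := diskProjection_idem q s e hq he hs
  have hf₀ : ∀ x : T.X 0, f.f 0 x = s (q x) := fun _ => rfl
  -- `Y` is the complement of the summand. In degree `0` it is the kernel of `q`, on which `ε`
  -- presents `M`.
  obtain ⟨Y, ι, r, h1, h2⟩ := IsIdempotentComplete.idempotents_split T (𝟙 T - f) (by
    simp [Preadditive.sub_comp, hf])
  have hrι : ∀ x : T.X 0, ι.f 0 (r.f 0 x) = x - s (q x) := fun x => by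
    rw [← hf₀]
    exact ConcreteCategory.congr_hom (HomologicalComplex.congr_hom h2 0) x
  have hιr : ∀ i (y : Y.X i), r.f i (ι.f i y) = y := fun i y =>
    ConcreteCategory.congr_hom (HomologicalComplex.congr_hom h1 i) y
  have hqι : ∀ y : Y.X 0, q (ι.f 0 y) = 0 := fun y => by
    have h3 := hrι (ι.f 0 y)
    rw [hιr] at h3
    have h4 := congrArg q (sub_eq_self.1 h3.symm)
    rw [map_zero] at h4
    exact (ConcreteCategory.congr_hom hs (q (ι.f 0 y))).symm.trans h4
  refine (isDingProjective_iff M).2 ⟨Y, hT.of_retract ι r h1, ι.f 0 ≫ ε, fun m => ?_, fun y => ?_⟩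
  · obtain ⟨x, hx, rfl⟩ := hsurj m
    refine ⟨r.f 0 x, congrArg ε ((hrι x).trans ?_)⟩
    rw [hx, map_zero, sub_zero]
  · constructor
    · intro hy
      obtain ⟨x, hx⟩ := hker _ (hqι y) hy
      exact ⟨r.f 1 x, by rw [← hom_d_apply, hx, hιr]⟩
    · rintro ⟨z, rfl⟩
      refine (congrArg ε (hom_d_apply ι 1 0 z)).trans ?_
      exact ConcreteCategory.congr_hom hε _

end Split

/-! ### From complete resolutions to Ding projective resolutions -/

namespace CompleteResolution

variable {M : ModuleCat.{u} R} (C : CompleteResolution (sphere M))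

/-- For `n < 0` every cycle in `P₀` lifts to a cycle of the exact complex `T`, so it is a boundary
and the augmentation kills it; but cycles map onto `M ≠ 0`. -/
theorem nonneg_of_bijective [Nontrivial M] {n : ℤ}
    (hn : ∀ i ≥ n, Function.Bijective (C.τ.f i)) : 0 ≤ n := by
  by_contra! h
  have := C.quasiIso
  obtain ⟨m, hm⟩ := exists_ne (0 : M)
  obtain ⟨z, hz, rfl⟩ := exists_cycle_augmentation_eq C.π m
  obtain ⟨t, rfl⟩ := (hn 0 (by lia)).2 z
  have ht : C.T.d 0 (-1) t = 0 :=
    (hn (-1) (by lia)).1 ((hom_d_apply C.τ 0 (-1) t).trans (hz.trans (map_zero _).symm))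
  obtain ⟨y, rfl⟩ := C.isTotallyFlatAcyclic.exists_d_apply_eq (i := 1) (j := 0) (k := -1)
    rfl rfl t ht
  refine hm ?_
  rw [hom_d_apply]
  exact ConcreteCategory.congr_hom (d_augmentation C.π) _

/-- The cokernel of `T₁ → T₀` is that of `P₁ → P₀`, an extension of the projective module of
boundaries by `M`. -/
theorem isDingProjective (hn : ∀ i ≥ 0, Function.Bijective (C.τ.f i)) : IsDingProjective M := by
  have := C.quasiIso
  have := C.isDGProjective.projective_boundaries
    (fun i hi => exactAt_of_quasiIso_sphere C.π i hi.ne)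
  refine C.isTotallyFlatAcyclic.isDingProjective_of_split (C.τ.f 0 ≫ toBoundaries C.P) ?_
    ((toBoundaries_surjective C.P).comp (hn 0 le_rfl).2) (C.τ.f 0 ≫ augmentation C.π) ?_
    (fun m => ?_) (fun x hx hx' => ?_)
  · rw [← C.τ.comm_assoc, d_toBoundaries, comp_zero]
  · rw [← C.τ.comm_assoc, d_augmentation, comp_zero]
  · obtain ⟨z, hz, rfl⟩ := exists_cycle_augmentation_eq C.π m
    obtain ⟨t, rfl⟩ := (hn 0 le_rfl).2 z
    exact ⟨t, (toBoundaries_eq_zero C.P).2 hz, rfl⟩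
  · obtain ⟨p, hp⟩ := exists_d_eq_of_augmentation_eq_zero C.π (C.τ.f 0 x)
      ((toBoundaries_eq_zero C.P).1 hx) hx'
    obtain ⟨y, rfl⟩ := (hn 1 (by simp)).2 p
    exact ⟨y, (hn 0 le_rfl).1 ((hom_d_apply C.τ 1 0 y).trans hp)⟩

/-- The degree-zero term is `Z₀` rather than `P₀`, because `M` is a quotient of the cycles only.
This requires `n ≥ 1`; length `0` is the splitting argument. -/
theorem nonempty_dingResolution {n : ℕ} (hn : ∀ i ≥ (n : ℤ), Function.Bijective (C.τ.f i)) :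
    Nonempty (DingResolution M n) := by
  cases n with
  | zero => exact ⟨(C.isDingProjective hn).resolution⟩
  | succ n =>
    have := C.quasiIso
    have hex := exactAt_of_quasiIso_sphere C.π
    obtain ⟨D⟩ := nonempty_dingResolution_coker C.isDGProjective.projective
      (fun i hi => hex i hi.ne') n (0 + 1) (by simp)
      (isDingProjective_coker C.isTotallyFlatAcyclic C.τ
        (fun i hi => hn i (by push_cast; lia)))
    let Z : ModuleCat.{u} R := ModuleCat.of R (LinearMap.ker (C.P.d 0 (-1)).hom)
    have := C.isDGProjective.projective_cycles (fun i hi => hex i hi.ne)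
    let δ : C.P.X (0 + 1) ⟶ Z := ModuleCat.ofHom ((C.P.d (0 + 1) 0).hom.codRestrict _
      (fun x => d_d_apply C.P (0 + 1) 0 (-1) x))
    have hδ : ∀ x, δ x = 0 ↔ C.P.d (0 + 1) 0 x = 0 := fun x => Subtype.ext_iff
    obtain ⟨f, hf⟩ := exists_cokerπ_comp_eq C.P (0 + 1) δ (by
      ext x
      exact congrArg Subtype.val ((hδ _).2 (d_d_apply C.P (0 + 1 + 1) (0 + 1) 0 x)))
    refine ⟨D.cons (isDingProjective_of_projective Z) f
      (ModuleCat.ofHom (LinearMap.ker (C.P.d 0 (-1)).hom).subtype ≫ augmentation C.π)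
      ?_ (fun z => ?_) (fun m => ?_)⟩
    · rw [injective_iff_map_eq_zero]
      intro a ha
      obtain ⟨x, rfl⟩ := cokerπ_surjective C.P _ a
      rw [hf, hδ] at ha
      exact (cokerπ_eq_zero C.P).2 ((exactAt_iff_forall C.P (c := .down ℤ) (i := 0 + 1 + 1)
        (j := 0 + 1) (k := 0) rfl rfl).1 (hex _ (by simp)) x ha)
    · constructor
      · intro hz
        obtain ⟨y, hy⟩ := exists_d_eq_of_augmentation_eq_zero C.π z.1 z.2 hz
        exact ⟨cokerπ C.P (0 + 1) y, (hf y).trans (Subtype.ext hy)⟩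
      · rintro ⟨a, rfl⟩
        obtain ⟨y, rfl⟩ := cokerπ_surjective C.P _ a
        rw [hf]
        exact ConcreteCategory.congr_hom (d_augmentation C.π) y
    · obtain ⟨z, hz, rfl⟩ := exists_cycle_augmentation_eq C.π m
      exact ⟨⟨z, hz⟩, rfl⟩

end CompleteResolution

end Ding

end

theorem mainTheorem4 {R : Type u} [Ring R] (M : ModuleCat.{u} R) (hM : Nontrivial M) :
    Ding.complexDpd (Ding.sphere M) = Ding.moduleDpd M := by
  unfold Ding.complexDpd Ding.moduleDpd
  congr 1
  ext x
  constructor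
  · rintro ⟨n, ⟨C, hC⟩, rfl⟩
    -- Nontriviality of `M` matters here: for `M = 0` the zero resolution allows every integer `n`,
    -- so the complex dimension would be `-∞` and the module dimension `0`.
    lift n to ℕ using C.nonneg_of_bijective hC
    exact ⟨n, C.nonempty_dingResolution hC, rfl⟩
  · rintro ⟨n, ⟨D⟩, rfl⟩
    exact ⟨n, D.hasCompleteResolution.exists_completeResolution, rfl⟩
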